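/- Let $a,b,m,k>0$ and $0<L_1<L_2<L_3$. Put $I=(L_1,L_2)$ and $O=(0,L_1)\cup(L_2,L_3)$; all function spaces are complex-valued. Let $\mathcal H_F$ be the space of all $$U=[u^1,v^1,\theta,u^2,v^2]'\in H^1(I)\times H^1(O)\times L^2(I)\times L^2(I)\times L^2(O)$$ with $v^1(0)=v^1(L_3)=0$ and $u^1(L_i)=v^1(L_i)$ for $i=1,2$, equipped with the inner product $$\langle U,\tilde U\rangle_{\mathcal H_F}=\int_I\big(a\,u^1_x\overline{\tilde u^1_x}+u^2\overline{\tilde u^2}+\theta\overline{\tilde\theta}\big)\,dx+\int_O\big(b\,v^1_x\overline{\tilde v^1_x}+v^2\overline{\tilde v^2}\big)\,dx .$$ Let $\mathcal A_F\colon D(\mathcal A_F)\subseteq\mathcal H_F\to\mathcal H_F$ be the operator $$\mathcal A_F U=[u^2,\;v^2,\;k^2\theta_{xx}-m u^2_x,\;a u^1_{xx}-m\theta_x,\;b v^1_{xx}]'$$ whose domain $D(\mathcal A_F)$ consists of all $U\in\mathcal H_F$ with $u^1,\theta\in H^2(I)$, $v^1\in H^2(O)$, $u^2\in H^1(I)$,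 $v^2\in H^1(O)$ such that $v^2(0)=v^2(L_3)=0$ and, for $i=1,2$, $u^2(L_i)=v^2(L_i)$, $a u^1_x(L_i)-m\theta(L_i)=b v^1_x(L_i)$ and $\theta_x(L_i)=0$. Then $0\in\sigma(\mathcal A_F)$ and $i\mathbb R\cap\sigma(\mathcal A_F)=\{0\}$. Moreover, the stationary solutions of the Cauchy problem $\frac{d}{dt}U(t)=\mathcal A_FU(t)$ $(t\ge0)$, $U(0)=U_0\in\mathcal H_F$, that is, the states whose constant trajectory is a classical solution, are exactly the elements of $$\ker(\mathcal A_F)=\operatorname{span}\{[\zeta^1,\zeta^2,\zeta^3,0,0]'\}\subseteq\mathcal H_F,$$ where $$\zeta^1(x)=\frac{L_2-L_1-L_3}{L_1L_3}\,x+1,\qquad \zeta^2(x)=\begin{cases}\frac{L_2-L_1}{L_1L_3}\,x,& x\in[0,L_1],\\[2pt] \frac{L_2-L_1}{L_1L_3}\,x-\frac{L_2-L_1}{L_1},& x\in[L_2,L_3],\end{cases}$$ $$\zeta^3(x)=\frac{a(L_2-L_1-L_3)-b(L_2-L_1)}{m\,L_1L_3}.$$ -/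

import Mathlib

open MeasureTheory Set Filter Topology
open scoped ContDiff

noncomputable section

namespace Transmission

/-! ## Sobolev spaces on open subsets of the line -/

/-- The complex Hilbert space `L²(Ω)`. -/
abbrev L2 (Ω : Set ℝ) : Type := Lp ℂ 2 (volume.restrict Ω)

/-- `g` is the weak derivative of `f` on `Ω`: `∫ φ' f = - ∫ φ g` for all test functions
`φ ∈ C_c^∞(Ω)`. -/
def HasWeakDeriv {Ω : Set ℝ} (f g : L2 Ω) : Prop :=
  ∀ φ : ℝ → ℝ, ContDiff ℝ ∞ φ → HasCompactSupport φ → tsupport φ ⊆ Ω →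
    ∫ x in Ω, deriv φ x • f x = -∫ x in Ω, φ x • g x

lemma L2.locallyIntegrable {Ω : Set ℝ} (f : L2 Ω) :
    LocallyIntegrable (f : ℝ → ℂ) (volume.restrict Ω) :=
  (Lp.memLp f).locallyIntegrable (by norm_num)

lemma integrable_test_smul {Ω : Set ℝ} (f : L2 Ω) {φ : ℝ → ℝ} (hφ : Continuous φ)
    (hc : HasCompactSupport φ) : Integrable (fun x => φ x • f x) (volume.restrict Ω) :=
  f.locallyIntegrable.integrable_smul_left_of_hasCompactSupport hφ hc

lemma HasWeakDeriv.add {Ω : Set ℝ} {f g f' g' : L2 Ω} (h : HasWeakDeriv f g)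
    (h' : HasWeakDeriv f' g') : HasWeakDeriv (f + f') (g + g') := by
  intro φ hφ hc hs
  have hφ' : Continuous (deriv φ) := hφ.continuous_deriv (by simp)
  have e1 : ∫ x in Ω, deriv φ x • (f + f' : L2 Ω) x
      = ∫ x in Ω, (deriv φ x • f x + deriv φ x • f' x) := by
    refine integral_congr_ae ?_
    filter_upwards [Lp.coeFn_add f f'] with x hx
    rw [hx, Pi.add_apply, smul_add]
  have e2 : ∫ x in Ω, φ x • (g + g' : L2 Ω) x
      = ∫ x in Ω, (φ x • g x + φ x • g' x) := by
    refine integral_congr_ae ?_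
    filter_upwards [Lp.coeFn_add g g'] with x hx
    rw [hx, Pi.add_apply, smul_add]
  rw [e1, e2, integral_add (integrable_test_smul f hφ' hc.deriv)
    (integrable_test_smul f' hφ' hc.deriv), integral_add
    (integrable_test_smul g hφ.continuous hc) (integrable_test_smul g' hφ.continuous hc),
    h φ hφ hc hs, h' φ hφ hc hs]
  ring

lemma HasWeakDeriv.smul {Ω : Set ℝ} {f g : L2 Ω} (c : ℂ) (h : HasWeakDeriv f g) :
    HasWeakDeriv (c • f) (c • g) := by
  intro φ hφ hc hs
  have e1 : ∫ x in Ω, deriv φ x • (c • f : L2 Ω) x = ∫ x in Ω, c • (deriv φ x • f x) := by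
    refine integral_congr_ae ?_
    filter_upwards [Lp.coeFn_smul c f] with x hx
    rw [hx, Pi.smul_apply, smul_comm]
  have e2 : ∫ x in Ω, φ x • (c • g : L2 Ω) x = ∫ x in Ω, c • (φ x • g x) := by
    refine integral_congr_ae ?_
    filter_upwards [Lp.coeFn_smul c g] with x hx
    rw [hx, Pi.smul_apply, smul_comm]
  rw [e1, e2, integral_smul, integral_smul, h φ hφ hc hs, smul_neg]

lemma HasWeakDeriv.zero {Ω : Set ℝ} : HasWeakDeriv (0 : L2 Ω) 0 := by
  simpa using (HasWeakDeriv.smul (0 : ℂ) (f := (0 : L2 Ω)) (g := 0) (by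
    intro φ _ _ _
    have e : ∀ ψ : ℝ → ℝ, ∫ x in Ω, ψ x • (0 : L2 Ω) x = 0 := by
      intro ψ
      rw [← integral_zero ℝ ℂ (μ := volume.restrict Ω)]
      refine integral_congr_ae ?_
      filter_upwards [Lp.coeFn_zero ℂ 2 (volume.restrict Ω)] with x hx
      rw [hx, Pi.zero_apply, smul_zero]
    rw [e, e, neg_zero]))

lemma HasWeakDeriv.unique {Ω : Set ℝ} (hΩ : IsOpen Ω) {f g g' : L2 Ω} (h : HasWeakDeriv f g)
    (h' : HasWeakDeriv f g') : g = g' := by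
  have hl : LocallyIntegrableOn (fun x => g x - g' x) Ω volume := by
    have := (g.locallyIntegrable.sub g'.locallyIntegrable)
    exact locallyIntegrableOn_of_locallyIntegrable_restrict this
  have key := hΩ.ae_eq_zero_of_integral_contDiff_smul_eq_zero hl (by
    intro φ hφ hc hs
    have h1 := h φ hφ hc hs
    have h2 := h' φ hφ hc hs
    rw [h1] at h2
    have h3 : ∫ x in Ω, φ x • (g x - g' x) = 0 := by
      simp_rw [smul_sub]
      rw [integral_sub (integrable_test_smul g hφ.continuous hc)
        (integrable_test_smul g' hφ.continuous hc), sub_eq_zero]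
      exact neg_injective h2
    rw [← h3]
    refine (setIntegral_eq_integral_of_forall_compl_eq_zero fun x hx => ?_).symm
    rw [image_eq_zero_of_notMem_tsupport (fun hx' => hx (hs hx')), zero_smul])
  refine Lp.ext ?_
  filter_upwards [(ae_restrict_iff' hΩ.measurableSet).2 key] with x hx
  exact sub_eq_zero.1 hx

/-- The Sobolev space `H¹(Ω)`. -/
def H1 (Ω : Set ℝ) : Submodule ℂ (L2 Ω) where
  carrier := {f | ∃ g : L2 Ω, HasWeakDeriv f g}
  add_mem' := by
    rintro f f' ⟨g, hg⟩ ⟨g', hg'⟩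
    exact ⟨g + g', hg.add hg'⟩
  zero_mem' := ⟨0, HasWeakDeriv.zero⟩
  smul_mem' := by
    rintro c f ⟨g, hg⟩
    exact ⟨c • g, hg.smul c⟩

open Classical in
/-- The weak derivative of `f ∈ H¹(Ω)` (and `0` if `f ∉ H¹(Ω)`). -/
def wderiv {Ω : Set ℝ} (f : L2 Ω) : L2 Ω :=
  if h : f ∈ H1 Ω then h.choose else 0

/-- The Sobolev space `H²(Ω)`. -/
def H2 (Ω : Set ℝ) : Set (L2 Ω) := {f | f ∈ H1 Ω ∧ wderiv f ∈ H1 Ω}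

lemma hasWeakDeriv_wderiv {Ω : Set ℝ} {f : L2 Ω} (h : f ∈ H1 Ω) : HasWeakDeriv f (wderiv f) := by
  rw [wderiv, dif_pos h]
  exact h.choose_spec

lemma HasWeakDeriv.wderiv_eq {Ω : Set ℝ} (hΩ : IsOpen Ω) {f g : L2 Ω} (h : HasWeakDeriv f g) :
    wderiv f = g :=
  (hasWeakDeriv_wderiv (f := f) ⟨g, h⟩).unique hΩ h

lemma wderiv_add {Ω : Set ℝ} (hΩ : IsOpen Ω) {f g : L2 Ω} (hf : f ∈ H1 Ω) (hg : g ∈ H1 Ω) :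
    wderiv (f + g) = wderiv f + wderiv g :=
  ((hasWeakDeriv_wderiv hf).add (hasWeakDeriv_wderiv hg)).wderiv_eq hΩ

lemma wderiv_smul {Ω : Set ℝ} (hΩ : IsOpen Ω) (c : ℂ) {f : L2 Ω} (hf : f ∈ H1 Ω) :
    wderiv (c • f) = c • wderiv f :=
  ((hasWeakDeriv_wderiv hf).smul c).wderiv_eq hΩ

lemma wderiv_zero {Ω : Set ℝ} (hΩ : IsOpen Ω) : wderiv (0 : L2 Ω) = 0 :=
  HasWeakDeriv.zero.wderiv_eq hΩ

lemma H2_add {Ω : Set ℝ} (hΩ : IsOpen Ω) {f g : L2 Ω} (hf : f ∈ H2 Ω) (hg : g ∈ H2 Ω) :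
    f + g ∈ H2 Ω :=
  ⟨add_mem hf.1 hg.1, by rw [wderiv_add hΩ hf.1 hg.1]; exact add_mem hf.2 hg.2⟩

lemma H2_smul {Ω : Set ℝ} (hΩ : IsOpen Ω) (c : ℂ) {f : L2 Ω} (hf : f ∈ H2 Ω) :
    c • f ∈ H2 Ω :=
  ⟨Submodule.smul_mem _ c hf.1, by
    rw [wderiv_smul hΩ c hf.1]; exact Submodule.smul_mem _ c hf.2⟩

lemma H2_zero {Ω : Set ℝ} (hΩ : IsOpen Ω) : (0 : L2 Ω) ∈ H2 Ω :=
  ⟨zero_mem _, by rw [wderiv_zero hΩ]; exact zero_mem _⟩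

/-- `c` is the representative of `f` that is continuous up to the boundary of `Ω`. On `closure Ω`
it is unique, and it exists for `f ∈ H¹(Ω)` with `Ω` a finite union of bounded intervals with
disjoint closures; the boundary values of `f` are the values of `c`. -/
def IsContRep {Ω : Set ℝ} (f : L2 Ω) (c : ℝ → ℂ) : Prop :=
  ContinuousOn c (closure Ω) ∧ (f : ℝ → ℂ) =ᵐ[volume.restrict Ω] c

lemma IsContRep.add {Ω : Set ℝ} {f g : L2 Ω} {c d : ℝ → ℂ} (hf : IsContRep f c)
    (hg : IsContRep g d) : IsContRep (f + g) (c + d) :=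
  ⟨hf.1.add hg.1, (Lp.coeFn_add f g).trans (hf.2.add hg.2)⟩

lemma IsContRep.smul {Ω : Set ℝ} {f : L2 Ω} {c : ℝ → ℂ} (z : ℂ) (hf : IsContRep f c) :
    IsContRep (z • f) (z • c) :=
  ⟨hf.1.const_smul z, (Lp.coeFn_smul z f).trans (hf.2.const_smul z)⟩

lemma IsContRep.zero {Ω : Set ℝ} : IsContRep (0 : L2 Ω) (0 : ℝ → ℂ) :=
  ⟨continuousOn_const, Lp.coeFn_zero _ _ _⟩

/-! ### A function with vanishing weak derivative is constant -/

lemma ae_const_of_integral_deriv_smul_eq_zero {a b : ℝ} (hab : a < b) {f : ℝ → ℂ}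
    (hf : LocallyIntegrableOn f (Ioo a b) volume)
    (h : ∀ φ : ℝ → ℝ, ContDiff ℝ ∞ φ → HasCompactSupport φ → tsupport φ ⊆ Ioo a b →
      ∫ x, deriv φ x • f x = 0) :
    ∃ c : ℂ, ∀ᵐ x ∂volume, x ∈ Ioo a b → f x = c := by
  have hint : ∀ g : ℝ → ℝ, ContDiff ℝ ∞ g → HasCompactSupport g → tsupport g ⊆ Ioo a b →
      Integrable (fun x => g x • f x) volume := by
    intro g hg hc hs
    have h1 : IntegrableOn f (tsupport g) volume := hf.integrableOn_compact_subset hs hc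
    have h2 : IntegrableOn (fun x => g x • f x) (tsupport g) volume :=
      h1.continuousOn_smul hg.continuous.continuousOn hc
    refine (integrableOn_iff_integrable_of_support_subset ?_).1 h2
    intro x hx
    by_contra hx'
    exact hx (by simp [image_eq_zero_of_notMem_tsupport hx'])
  have hmean : ∀ g : ℝ → ℝ, ContDiff ℝ ∞ g → HasCompactSupport g → tsupport g ⊆ Ioo a b →
      ∫ x, g x = 0 → ∫ x, g x • f x = 0 := by
    intro g hg hc hs h0
    have hcont := hg.continuous
    set Φ : ℝ → ℝ := fun x => ∫ t in a..x, g t with hΦ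
    have hd : ∀ x, HasDerivAt Φ (g x) x := fun x =>
      intervalIntegral.integral_hasDerivAt_right (hcont.intervalIntegrable _ _)
        (hcont.stronglyMeasurableAtFilter _ _) hcont.continuousAt
    have hderiv : deriv Φ = g := funext fun x => (hd x).deriv
    have hΦs : ContDiff ℝ ∞ Φ := by
      rw [contDiff_infty_iff_deriv, hderiv]
      exact ⟨fun x => (hd x).differentiableAt, hg⟩
    rcases (tsupport g).eq_empty_or_nonempty with he | hne
    · have hg0 : g = 0 := tsupport_eq_empty_iff.1 he
      simp [hg0]
    have hcK : IsCompact (tsupport g) := hc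
    set p := sInf (tsupport g)
    set q := sSup (tsupport g)
    have hp : p ∈ tsupport g := hcK.sInf_mem hne
    have hq : q ∈ tsupport g := hcK.sSup_mem hne
    have hsub : ∀ x ∈ tsupport g, p ≤ x ∧ x ≤ q := fun x hx =>
      ⟨csInf_le hcK.bddBelow hx, le_csSup hcK.bddAbove hx⟩
    have hg_zero : ∀ x, x ∉ Icc p q → g x = 0 := fun x hx =>
      image_eq_zero_of_notMem_tsupport fun hx' => hx (hsub x hx')
    have hap := (hs hp).1
    have hqb := (hs hq).2
    have hsupp : Function.support Φ ⊆ Icc p q := by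
      intro x hx
      by_contra hx'
      apply hx
      rw [mem_Icc, not_and_or, not_le, not_le] at hx'
      rcases hx' with hx' | hx'
      · change ∫ t in a..x, g t = 0
        have : ∫ t in a..x, g t = ∫ t in a..x, (0 : ℝ) := by
          refine intervalIntegral.integral_congr fun t ht => hg_zero t fun ht' => ?_
          have : t ≤ max a x := (mem_uIcc.1 ht).elim
            (fun h => h.2.trans (le_max_right _ _)) (fun h => h.2.trans (le_max_left _ _))
          exact absurd ht'.1 (not_le.2 (this.trans_lt (max_lt hap hx')))
        rw [this]; simp
      · change ∫ t in a..x, g t = 0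
        have hax : a ≤ x := by
          have := (hsub q hq).1
          linarith
        rw [intervalIntegral.integral_of_le hax, ← h0]
        refine setIntegral_eq_integral_of_forall_compl_eq_zero fun t ht => hg_zero t fun ht' => ?_
        exact ht ⟨hap.trans_le ht'.1, ht'.2.trans hx'.le⟩
    have hts : tsupport Φ ⊆ Icc p q := closure_minimal hsupp isClosed_Icc
    have hΦc : HasCompactSupport Φ := HasCompactSupport.of_support_subset_isCompact isCompact_Icc hsupp
    have := h Φ hΦs hΦc (hts.trans fun x hx => ⟨hap.trans_le hx.1, hx.2.trans_lt hqb⟩)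
    rwa [hderiv] at this
  let ψ₀ : ContDiffBump ((a + b) / 2) := ⟨(b - a) / 8, (b - a) / 4, by linarith, by linarith⟩
  set ψ : ℝ → ℝ := ψ₀.normed volume
  have hψ : ContDiff ℝ ∞ ψ := ψ₀.contDiff_normed
  have hψc : HasCompactSupport ψ := ψ₀.hasCompactSupport_normed
  have hψs : tsupport ψ ⊆ Ioo a b := by
    rw [ψ₀.tsupport_normed_eq, Real.closedBall_eq_Icc]
    intro x hx
    have h1 : (a + b) / 2 - (b - a) / 4 ≤ x := hx.1
    have h2 : x ≤ (a + b) / 2 + (b - a) / 4 := hx.2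
    constructor <;> linarith
  have hψ1 : ∫ x, ψ x = 1 := ψ₀.integral_normed
  refine ⟨∫ x, ψ x • f x, ?_⟩
  set c := ∫ x, ψ x • f x with hcdef
  have hl : LocallyIntegrableOn (fun x => f x - c) (Ioo a b) volume :=
    hf.sub ((locallyIntegrable_const c).locallyIntegrableOn _)
  have key := isOpen_Ioo.ae_eq_zero_of_integral_contDiff_smul_eq_zero hl (by
    intro g hg hgc hgs
    set I := ∫ x, g x with hI
    have hgi : Integrable g volume := hg.continuous.integrable_of_hasCompactSupport hgc
    have hψi : Integrable ψ volume := hψ.continuous.integrable_of_hasCompactSupport hψc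
    have hsm : ContDiff ℝ ∞ (fun x => g x - I * ψ x) := hg.sub (contDiff_const.mul hψ)
    have hss : tsupport (fun x => g x - I * ψ x) ⊆ tsupport g ∪ tsupport ψ := by
      refine closure_minimal ?_ ((isClosed_tsupport _).union (isClosed_tsupport _))
      intro x hx
      by_contra hx'
      rw [mem_union, not_or] at hx'
      exact hx (by simp [image_eq_zero_of_notMem_tsupport hx'.1,
        image_eq_zero_of_notMem_tsupport hx'.2])
    have hcs : HasCompactSupport (fun x => g x - I * ψ x) :=
      IsCompact.of_isClosed_subset (hgc.isCompact.union hψc.isCompact) (isClosed_tsupport _) hss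
    have hz := hmean _ hsm hcs (hss.trans (union_subset hgs hψs)) (by
      rw [integral_sub hgi (hψi.const_mul I), integral_const_mul, hψ1, mul_one, hI, sub_self])
    have e1 : ∫ x, (g x - I * ψ x) • f x = (∫ x, g x • f x) - I • c := by
      have : ∀ x, (g x - I * ψ x) • f x = g x • f x - I • (ψ x • f x) := fun x => by
        rw [sub_smul, mul_smul]
      simp_rw [this]
      have hi : Integrable (fun x => I • (ψ x • f x)) volume := (hint ψ hψ hψc hψs).smul I
      rw [integral_sub (hint g hg hgc hgs) hi, integral_smul]
    have e2 : ∫ x, g x • (f x - c) = (∫ x, g x • f x) - I • c := by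
      simp_rw [smul_sub]
      rw [integral_sub (hint g hg hgc hgs) (hgi.smul_const c), integral_smul_const]
    rw [e2, ← e1, hz])
  filter_upwards [key] with x hx hx'
  exact sub_eq_zero.1 (hx hx')

/-- If the weak derivative of `f` vanishes, then its continuous representative is constant on each
interval in `Ω`. -/
lemma IsContRep.eq_of_hasWeakDeriv_zero {Ω : Set ℝ} {f : L2 Ω} {c : ℝ → ℂ}
    (hf : IsContRep f c) (h : HasWeakDeriv f 0) {a b : ℝ} (hab : a < b) (hs : Ioo a b ⊆ Ω) :
    ∃ z : ℂ, ∀ x ∈ Icc a b, c x = z := by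
  have hl : LocallyIntegrableOn (f : ℝ → ℂ) (Ioo a b) volume := by
    refine LocallyIntegrableOn.mono_set ?_ hs
    exact locallyIntegrableOn_of_locallyIntegrable_restrict f.locallyIntegrable
  obtain ⟨z, hz⟩ := ae_const_of_integral_deriv_smul_eq_zero hab hl (by
    intro φ hφ hc hsφ
    have h1 := h φ hφ hc (hsφ.trans hs)
    have h2 : ∫ x in Ω, φ x • (0 : L2 Ω) x = 0 := by
      rw [← integral_zero ℝ ℂ (μ := volume.restrict Ω)]
      refine integral_congr_ae ?_
      filter_upwards [Lp.coeFn_zero ℂ 2 (volume.restrict Ω)] with x hx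
      rw [hx, Pi.zero_apply, smul_zero]
    rw [h2, neg_zero] at h1
    rw [← h1]
    refine (setIntegral_eq_integral_of_forall_compl_eq_zero fun x hx => ?_).symm
    have : deriv φ x = 0 := image_eq_zero_of_notMem_tsupport fun hx' =>
      hx (hs (hsφ (tsupport_deriv_subset hx')))
    rw [this, zero_smul])
  refine ⟨z, ?_⟩
  have hcl : Icc a b ⊆ closure Ω := by
    rw [← closure_Ioo hab.ne]
    exact closure_mono hs
  have hae : c =ᵐ[volume.restrict (Icc a b)] fun _ => z := by
    rw [← restrict_Ioo_eq_restrict_Icc]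
    have h1 : (f : ℝ → ℂ) =ᵐ[volume.restrict (Ioo a b)] c :=
      ae_mono (Measure.restrict_mono hs le_rfl) hf.2
    have h2 : ∀ᵐ x ∂volume.restrict (Ioo a b), f x = z := (ae_restrict_iff' measurableSet_Ioo).2 hz
    filter_upwards [h1, h2] with x hx hx'
    rw [← hx, hx']
  exact Measure.eqOn_Icc_of_ae_eq volume hab.ne hae (hf.1.mono hcl) continuousOn_const

/-! ## The bar and its state space -/

/-- An elastic - thermoelastic - elastic bar `[0, L₃]` whose thermoelastic part is `[L₁, L₂]`,
with positive material constants. -/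
structure Bar where
  (a b m k L₁ L₂ L₃ : ℝ)
  ha : 0 < a
  hb : 0 < b
  hm : 0 < m
  hk : 0 < k
  hL₁ : 0 < L₁
  hL₂ : L₁ < L₂
  hL₃ : L₂ < L₃

namespace Bar

variable (P : Bar)

/-- The thermoelastic part `(L₁, L₂)`. -/
def mid : Set ℝ := Ioo P.L₁ P.L₂

/-- The elastic parts `(0, L₁) ∪ (L₂, L₃)`. -/
def out : Set ℝ := Ioo 0 P.L₁ ∪ Ioo P.L₂ P.L₃

lemma isOpen_mid : IsOpen P.mid := isOpen_Ioo

lemma isOpen_out : IsOpen P.out := isOpen_Ioo.union isOpen_Ioo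

/-- `v(0) = v(L₃) = 0` and `u(Lᵢ) = v(Lᵢ)` for `i = 1, 2`. -/
def Compatible (u : L2 P.mid) (v : L2 P.out) : Prop :=
  ∃ c d : ℝ → ℂ, IsContRep u c ∧ IsContRep v d ∧ d 0 = 0 ∧ d P.L₃ = 0 ∧
    c P.L₁ = d P.L₁ ∧ c P.L₂ = d P.L₂

/-- `a u_x(Lᵢ) - m θ(Lᵢ) = b v_x(Lᵢ)` for `i = 1, 2`. -/
def ForceBalance (u θ : L2 P.mid) (v : L2 P.out) : Prop :=
  ∃ c t d : ℝ → ℂ, IsContRep (wderiv u) c ∧ IsContRep θ t ∧ IsContRep (wderiv v) d ∧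
    (P.a : ℂ) * c P.L₁ - P.m * t P.L₁ = P.b * d P.L₁ ∧
    (P.a : ℂ) * c P.L₂ - P.m * t P.L₂ = P.b * d P.L₂

/-- `θ_x(Lᵢ) = 0` for `i = 1, 2`. -/
def Insulated (θ : L2 P.mid) : Prop :=
  ∃ c : ℝ → ℂ, IsContRep (wderiv θ) c ∧ c P.L₁ = 0 ∧ c P.L₂ = 0

variable {P}

lemma Compatible.add {u u' : L2 P.mid} {v v' : L2 P.out} (h : P.Compatible u v)
    (h' : P.Compatible u' v') : P.Compatible (u + u') (v + v') := by
  obtain ⟨c, d, hc, hd, h1, h2, h3, h4⟩ := h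
  obtain ⟨c', d', hc', hd', h1', h2', h3', h4'⟩ := h'
  exact ⟨c + c', d + d', hc.add hc', hd.add hd', by simp [h1, h1'], by simp [h2, h2'],
    by simp [h3, h3'], by simp [h4, h4']⟩

lemma Compatible.smul {u : L2 P.mid} {v : L2 P.out} (z : ℂ) (h : P.Compatible u v) :
    P.Compatible (z • u) (z • v) := by
  obtain ⟨c, d, hc, hd, h1, h2, h3, h4⟩ := h
  exact ⟨z • c, z • d, hc.smul z, hd.smul z, by simp [h1], by simp [h2], by simp [h3],
    by simp [h4]⟩

lemma Compatible.zero : P.Compatible 0 0 :=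
  ⟨0, 0, IsContRep.zero, IsContRep.zero, rfl, rfl, rfl, rfl⟩

end Bar

/-- The state space `H_F` as a space of quintuples `[u¹, v¹, θ, u², v²]`. -/
def stateSubmodule (P : Bar) :
    Submodule ℂ (L2 P.mid × L2 P.out × L2 P.mid × L2 P.mid × L2 P.out) where
  carrier := {U | U.1 ∈ H1 P.mid ∧ U.2.1 ∈ H1 P.out ∧ P.Compatible U.1 U.2.1}
  add_mem' := by
    rintro U V ⟨h1, h2, h3⟩ ⟨h1', h2', h3'⟩
    exact ⟨add_mem h1 h1', add_mem h2 h2', h3.add h3'⟩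
  zero_mem' := ⟨zero_mem _, zero_mem _, Bar.Compatible.zero⟩
  smul_mem' := by
    rintro c U ⟨h1, h2, h3⟩
    exact ⟨Submodule.smul_mem _ c h1, Submodule.smul_mem _ c h2, h3.smul c⟩

/-- The state space `H_F`; its norm comes from the energy inner product below, not from the
ambient product of `L²` spaces. -/
def HF (P : Bar) : Type := ↥(stateSubmodule P)

namespace HF

variable {P : Bar}

instance : AddCommGroup (HF P) := inferInstanceAs (AddCommGroup ↥(stateSubmodule P))

instance : Module ℂ (HF P) := inferInstanceAs (Module ℂ ↥(stateSubmodule P))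

/-- The displacement `u¹` of the thermoelastic part. -/
def u1 (U : HF P) : L2 P.mid := U.1.1
/-- The displacement `v¹` of the elastic parts. -/
def v1 (U : HF P) : L2 P.out := U.1.2.1
/-- The temperature `θ`. -/
def θ (U : HF P) : L2 P.mid := U.1.2.2.1
/-- The velocity `u²` of the thermoelastic part. -/
def u2 (U : HF P) : L2 P.mid := U.1.2.2.2.1
/-- The velocity `v²` of the elastic parts. -/
def v2 (U : HF P) : L2 P.out := U.1.2.2.2.2

lemma u1_mem (U : HF P) : U.u1 ∈ H1 P.mid := U.2.1
lemma v1_mem (U : HF P) : U.v1 ∈ H1 P.out := U.2.2.1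
lemma compatible (U : HF P) : P.Compatible U.u1 U.v1 := U.2.2.2

/-- The state with the given components. -/
def mk (u1 : L2 P.mid) (v1 : L2 P.out) (θ u2 : L2 P.mid) (v2 : L2 P.out) (hu : u1 ∈ H1 P.mid)
    (hv : v1 ∈ H1 P.out) (hc : P.Compatible u1 v1) : HF P :=
  ⟨(u1, v1, θ, u2, v2), hu, hv, hc⟩

section

variable (a1 : L2 P.mid) (b1 : L2 P.out) (t a2 : L2 P.mid) (b2 : L2 P.out) (hu : a1 ∈ H1 P.mid)
  (hv : b1 ∈ H1 P.out) (hc : P.Compatible a1 b1)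

@[simp] lemma u1_mk : (mk a1 b1 t a2 b2 hu hv hc).u1 = a1 := rfl
@[simp] lemma v1_mk : (mk a1 b1 t a2 b2 hu hv hc).v1 = b1 := rfl
@[simp] lemma θ_mk : (mk a1 b1 t a2 b2 hu hv hc).θ = t := rfl
@[simp] lemma u2_mk : (mk a1 b1 t a2 b2 hu hv hc).u2 = a2 := rfl
@[simp] lemma v2_mk : (mk a1 b1 t a2 b2 hu hv hc).v2 = b2 := rfl

end

@[simp] lemma u1_add (U V : HF P) : (U + V).u1 = U.u1 + V.u1 := rfl
@[simp] lemma v1_add (U V : HF P) : (U + V).v1 = U.v1 + V.v1 := rfl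
@[simp] lemma θ_add (U V : HF P) : (U + V).θ = U.θ + V.θ := rfl
@[simp] lemma u2_add (U V : HF P) : (U + V).u2 = U.u2 + V.u2 := rfl
@[simp] lemma v2_add (U V : HF P) : (U + V).v2 = U.v2 + V.v2 := rfl
@[simp] lemma u1_smul (c : ℂ) (U : HF P) : (c • U).u1 = c • U.u1 := rfl
@[simp] lemma v1_smul (c : ℂ) (U : HF P) : (c • U).v1 = c • U.v1 := rfl
@[simp] lemma θ_smul (c : ℂ) (U : HF P) : (c • U).θ = c • U.θ := rfl
@[simp] lemma u2_smul (c : ℂ) (U : HF P) : (c • U).u2 = c • U.u2 := rfl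
@[simp] lemma v2_smul (c : ℂ) (U : HF P) : (c • U).v2 = c • U.v2 := rfl
@[simp] lemma u1_zero : (0 : HF P).u1 = 0 := rfl
@[simp] lemma v1_zero : (0 : HF P).v1 = 0 := rfl
@[simp] lemma θ_zero : (0 : HF P).θ = 0 := rfl
@[simp] lemma u2_zero : (0 : HF P).u2 = 0 := rfl
@[simp] lemma v2_zero : (0 : HF P).v2 = 0 := rfl

@[ext] lemma ext {U V : HF P} (h1 : U.u1 = V.u1) (h2 : U.v1 = V.v1) (h3 : U.θ = V.θ)
    (h4 : U.u2 = V.u2) (h5 : U.v2 = V.v2) : U = V :=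
  Subtype.ext (Prod.ext h1 (Prod.ext h2 (Prod.ext h3 (Prod.ext h4 h5))))

/-- The energy inner product
`∫_mid (a u¹_x ũ¹_x + u² ũ² + θ θ̃) + ∫_out (b v¹_x ṽ¹_x + v² ṽ²)`, conjugate-linear in the first
argument as everywhere in Mathlib. -/
def energyInner (U V : HF P) : ℂ :=
  P.a * inner ℂ (wderiv U.u1) (wderiv V.u1) + inner ℂ U.u2 V.u2 + inner ℂ U.θ V.θ
    + P.b * inner ℂ (wderiv U.v1) (wderiv V.v1) + inner ℂ U.v2 V.v2

lemma re_energyInner_self (U : HF P) :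
    (energyInner U U).re = P.a * ‖wderiv U.u1‖ ^ 2 + ‖U.u2‖ ^ 2 + ‖U.θ‖ ^ 2
      + P.b * ‖wderiv U.v1‖ ^ 2 + ‖U.v2‖ ^ 2 := by
  simp only [energyInner, inner_self_eq_norm_sq_to_K, Complex.add_re, Complex.coe_algebraMap,
    ← Complex.ofReal_pow, ← Complex.ofReal_mul, Complex.ofReal_re]

lemma displacement_eq_zero (U : HF P) (hu : wderiv U.u1 = 0) (hv : wderiv U.v1 = 0) :
    U.u1 = 0 ∧ U.v1 = 0 := by
  obtain ⟨c, d, hc, hd, h0, h3, h1, h2⟩ := U.compatible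
  have wu : HasWeakDeriv U.u1 0 := hu ▸ hasWeakDeriv_wderiv U.u1_mem
  have wv : HasWeakDeriv U.v1 0 := hv ▸ hasWeakDeriv_wderiv U.v1_mem
  obtain ⟨z1, e1⟩ := hd.eq_of_hasWeakDeriv_zero wv P.hL₁ subset_union_left
  obtain ⟨z2, e2⟩ := hd.eq_of_hasWeakDeriv_zero wv P.hL₃ subset_union_right
  obtain ⟨z3, e3⟩ := hc.eq_of_hasWeakDeriv_zero wu P.hL₂ subset_rfl
  have z1z : z1 = 0 := by rw [← e1 0 ⟨le_rfl, P.hL₁.le⟩, h0]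
  have z2z : z2 = 0 := by rw [← e2 P.L₃ ⟨P.hL₃.le, le_rfl⟩, h3]
  have z3z : z3 = 0 := by
    rw [← e3 P.L₁ ⟨le_rfl, P.hL₂.le⟩, h1, e1 P.L₁ ⟨P.hL₁.le, le_rfl⟩, z1z]
  constructor
  · refine Lp.ext ?_
    filter_upwards [hc.2, Lp.coeFn_zero ℂ 2 (volume.restrict P.mid),
      ae_restrict_mem P.isOpen_mid.measurableSet] with x hx hx0 hxm
    rw [hx, hx0, e3 x ⟨hxm.1.le, hxm.2.le⟩, z3z, Pi.zero_apply]
  · refine Lp.ext ?_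
    filter_upwards [hd.2, Lp.coeFn_zero ℂ 2 (volume.restrict P.out),
      ae_restrict_mem P.isOpen_out.measurableSet] with x hx hx0 hxm
    rw [hx, hx0, Pi.zero_apply]
    rcases hxm with hxm | hxm
    · rw [e1 x ⟨hxm.1.le, hxm.2.le⟩, z1z]
    · rw [e2 x ⟨hxm.1.le, hxm.2.le⟩, z2z]

/-- The energy inner product is a (positive definite) inner product. -/
@[reducible]
def innerCore (P : Bar) : InnerProductSpace.Core ℂ (HF P) where
  inner := energyInner
  conj_inner_symm U V := by
    simp only [energyInner, map_add, map_mul, inner_conj_symm, Complex.conj_ofReal]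
  re_inner_nonneg U := by
    have := P.ha
    have := P.hb
    change 0 ≤ (energyInner U U).re
    rw [re_energyInner_self]
    positivity
  add_left U V W := by
    simp only [energyInner, u1_add, v1_add, θ_add, u2_add, v2_add,
      wderiv_add P.isOpen_mid U.u1_mem V.u1_mem, wderiv_add P.isOpen_out U.v1_mem V.v1_mem,
      inner_add_left]
    ring
  smul_left U V c := by
    simp only [energyInner, u1_smul, v1_smul, θ_smul, u2_smul, v2_smul,
      wderiv_smul P.isOpen_mid c U.u1_mem, wderiv_smul P.isOpen_out c U.v1_mem, inner_smul_left]
    ring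
  definite U h := by
    have ha := P.ha
    have hb := P.hb
    have hr : (energyInner U U).re = 0 := by rw [show energyInner U U = 0 from h]; rfl
    rw [re_energyInner_self] at hr
    have p1 : 0 ≤ P.a * ‖wderiv U.u1‖ ^ 2 := by positivity
    have p2 : 0 ≤ ‖U.u2‖ ^ 2 := by positivity
    have p3 : 0 ≤ ‖U.θ‖ ^ 2 := by positivity
    have p4 : 0 ≤ P.b * ‖wderiv U.v1‖ ^ 2 := by positivity
    have p5 : 0 ≤ ‖U.v2‖ ^ 2 := by positivity
    have q1 : P.a * ‖wderiv U.u1‖ ^ 2 = 0 := by linarith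
    have q2 : ‖U.u2‖ ^ 2 = 0 := by linarith
    have q3 : ‖U.θ‖ ^ 2 = 0 := by linarith
    have q4 : P.b * ‖wderiv U.v1‖ ^ 2 = 0 := by linarith
    have q5 : ‖U.v2‖ ^ 2 = 0 := by linarith
    simp only [mul_eq_zero, ha.ne', hb.ne', false_or, ne_eq, OfNat.ofNat_ne_zero,
      not_false_eq_true, pow_eq_zero_iff, norm_eq_zero] at q1 q2 q3 q4 q5
    obtain ⟨r1, r2⟩ := displacement_eq_zero U q1 q4
    exact HF.ext r1 r2 q3 q2 q5

instance : NormedAddCommGroup (HF P) := (innerCore P).toNormedAddCommGroup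

instance : InnerProductSpace ℂ (HF P) := InnerProductSpace.ofCore (innerCore P).toCore

end HF

/-! ## The operator -/

/-- The domain `D(A_F)`. -/
def domAF (P : Bar) : Submodule ℂ (HF P) where
  carrier := {U | U.u1 ∈ H2 P.mid ∧ U.v1 ∈ H2 P.out ∧ U.θ ∈ H2 P.mid ∧
    U.u2 ∈ H1 P.mid ∧ U.v2 ∈ H1 P.out ∧ P.Compatible U.u2 U.v2 ∧
    P.ForceBalance U.u1 U.θ U.v1 ∧ P.Insulated U.θ}
  add_mem' := by
    rintro U V ⟨h1, h2, h3, h4, h5, h6, ⟨c, t, d, hc, ht, hd, e1, e2⟩, ⟨r, hr, r1, r2⟩⟩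
      ⟨h1', h2', h3', h4', h5', h6', ⟨c', t', d', hc', ht', hd', e1', e2'⟩, ⟨r', hr', r1', r2'⟩⟩
    refine ⟨H2_add P.isOpen_mid h1 h1', H2_add P.isOpen_out h2 h2', H2_add P.isOpen_mid h3 h3',
      add_mem h4 h4', add_mem h5 h5', h6.add h6', ⟨c + c', t + t', d + d', ?_, ht.add ht', ?_,
      ?_, ?_⟩, ⟨r + r', ?_, by simp [r1, r1'], by simp [r2, r2']⟩⟩
    · rw [HF.u1_add, wderiv_add P.isOpen_mid h1.1 h1'.1]
      exact hc.add hc'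
    · rw [HF.v1_add, wderiv_add P.isOpen_out h2.1 h2'.1]
      exact hd.add hd'
    · simp only [Pi.add_apply]
      linear_combination e1 + e1'
    · simp only [Pi.add_apply]
      linear_combination e2 + e2'
    · rw [HF.θ_add, wderiv_add P.isOpen_mid h3.1 h3'.1]
      exact hr.add hr'
  zero_mem' := by
    refine ⟨H2_zero P.isOpen_mid, H2_zero P.isOpen_out, H2_zero P.isOpen_mid, zero_mem _,
      zero_mem _, Bar.Compatible.zero, ⟨0, 0, 0, ?_, IsContRep.zero, ?_, by simp, by simp⟩,
      ⟨0, ?_, rfl, rfl⟩⟩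
    · rw [HF.u1_zero, wderiv_zero P.isOpen_mid]
      exact IsContRep.zero
    · rw [HF.v1_zero, wderiv_zero P.isOpen_out]
      exact IsContRep.zero
    · rw [HF.θ_zero, wderiv_zero P.isOpen_mid]
      exact IsContRep.zero
  smul_mem' := by
    rintro z U ⟨h1, h2, h3, h4, h5, h6, ⟨c, t, d, hc, ht, hd, e1, e2⟩, ⟨r, hr, r1, r2⟩⟩
    refine ⟨H2_smul P.isOpen_mid z h1, H2_smul P.isOpen_out z h2, H2_smul P.isOpen_mid z h3,
      Submodule.smul_mem _ z h4, Submodule.smul_mem _ z h5, h6.smul z,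
      ⟨z • c, z • t, z • d, ?_, ht.smul z, ?_, ?_, ?_⟩,
      ⟨z • r, ?_, by simp [r1], by simp [r2]⟩⟩
    · rw [HF.u1_smul, wderiv_smul P.isOpen_mid z h1.1]
      exact hc.smul z
    · rw [HF.v1_smul, wderiv_smul P.isOpen_out z h2.1]
      exact hd.smul z
    · simp only [Pi.smul_apply, smul_eq_mul]
      linear_combination z * e1
    · simp only [Pi.smul_apply, smul_eq_mul]
      linear_combination z * e2
    · rw [HF.θ_smul, wderiv_smul P.isOpen_mid z h3.1]
      exact hr.smul z

/-- The vector `[u², v², k² θ_xx - m u²_x, a u¹_xx - m θ_x, b v¹_xx]` for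
`[u¹, v¹, θ, u², v²] ∈ D(A_F)`. -/
def applyAF (P : Bar) (U : HF P) (hU : U ∈ domAF P) : HF P :=
  HF.mk U.u2 U.v2
    (((P.k : ℂ) ^ 2) • wderiv (wderiv U.θ) - (P.m : ℂ) • wderiv U.u2)
    ((P.a : ℂ) • wderiv (wderiv U.u1) - (P.m : ℂ) • wderiv U.θ)
    ((P.b : ℂ) • wderiv (wderiv U.v1))
    hU.2.2.2.1 hU.2.2.2.2.1 hU.2.2.2.2.2.1

lemma applyAF_add {P : Bar} {U V : HF P} (hU : U ∈ domAF P) (hV : V ∈ domAF P)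
    (hUV : U + V ∈ domAF P) : applyAF P (U + V) hUV = applyAF P U hU + applyAF P V hV := by
  obtain ⟨h1, h2, h3, h4, -⟩ := hU
  obtain ⟨h1', h2', h3', h4', -⟩ := hV
  apply HF.ext
  · simp only [applyAF, HF.u1_mk, HF.u1_add, HF.u2_add]
  · simp only [applyAF, HF.v1_mk, HF.v1_add, HF.v2_add]
  · simp only [applyAF, HF.θ_mk, HF.θ_add, HF.u2_add]
    rw [wderiv_add P.isOpen_mid h3.1 h3'.1, wderiv_add P.isOpen_mid h3.2 h3'.2,
      wderiv_add P.isOpen_mid h4 h4']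
    module
  · simp only [applyAF, HF.u2_mk, HF.u1_add, HF.u2_add, HF.θ_add]
    rw [wderiv_add P.isOpen_mid h1.1 h1'.1, wderiv_add P.isOpen_mid h1.2 h1'.2,
      wderiv_add P.isOpen_mid h3.1 h3'.1]
    module
  · simp only [applyAF, HF.v2_mk, HF.v1_add, HF.v2_add]
    rw [wderiv_add P.isOpen_out h2.1 h2'.1, wderiv_add P.isOpen_out h2.2 h2'.2]
    module

lemma applyAF_smul {P : Bar} (z : ℂ) {U : HF P} (hU : U ∈ domAF P) (hzU : z • U ∈ domAF P) :
    applyAF P (z • U) hzU = z • applyAF P U hU := by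
  obtain ⟨h1, h2, h3, h4, -⟩ := hU
  apply HF.ext
  · simp only [applyAF, HF.u1_mk, HF.u1_smul, HF.u2_smul]
  · simp only [applyAF, HF.v1_mk, HF.v1_smul, HF.v2_smul]
  · simp only [applyAF, HF.θ_mk, HF.θ_smul, HF.u2_smul]
    rw [wderiv_smul P.isOpen_mid z h3.1, wderiv_smul P.isOpen_mid z h3.2,
      wderiv_smul P.isOpen_mid z h4]
    module
  · simp only [applyAF, HF.u2_mk, HF.u1_smul, HF.u2_smul, HF.θ_smul]
    rw [wderiv_smul P.isOpen_mid z h1.1, wderiv_smul P.isOpen_mid z h1.2,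
      wderiv_smul P.isOpen_mid z h3.1]
    module
  · simp only [applyAF, HF.v2_mk, HF.v1_smul, HF.v2_smul]
    rw [wderiv_smul P.isOpen_out z h2.1, wderiv_smul P.isOpen_out z h2.2]
    module

/-- The operator `A_F [u¹, v¹, θ, u², v²] =
[u², v², k² θ_xx - m u²_x, a u¹_xx - m θ_x, b v¹_xx]` on `D(A_F)`. -/
def AF (P : Bar) : HF P →ₗ.[ℂ] HF P where
  domain := domAF P
  toFun :=
    { toFun := fun U => applyAF P U.1 U.2
      map_add' := fun U V => applyAF_add U.2 V.2 (U + V).2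
      map_smul' := fun z U => applyAF_smul z U.2 (z • U).2 }

/-! ## Unbounded operators: spectrum, kernel, Cauchy problem -/

section Unbounded

variable {E : Type*} [NormedAddCommGroup E] [NormedSpace ℂ E]

/-- The resolvent set of an unbounded operator: the `z` for which `z - A : D(A) → E` has an
everywhere defined bounded inverse `R`. -/
def resolventSetOf (A : E →ₗ.[ℂ] E) : Set ℂ :=
  {z | ∃ R : E →L[ℂ] E, (∀ y : E, ∃ h : R y ∈ A.domain, z • R y - A ⟨R y, h⟩ = y) ∧
    ∀ x : A.domain, R (z • (x : E) - A x) = x}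

/-- The spectrum of an unbounded operator. -/
def spectrumOf (A : E →ₗ.[ℂ] E) : Set ℂ := (resolventSetOf A)ᶜ

/-- The kernel of an unbounded operator, as a subspace of the whole space. -/
def kerOf (A : E →ₗ.[ℂ] E) : Submodule ℂ E := (LinearMap.ker A.toFun).map A.domain.subtype

/-- `U` is a classical solution of `U' = A U` on `[0, ∞)` with `U(0) = U₀`. -/
structure IsClassicalSolution (A : E →ₗ.[ℂ] E) (U₀ : E) (U : ℝ → E) : Prop where
  initial : U 0 = U₀
  contDiffOn : ContDiffOn ℝ 1 U (Ici 0)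
  equation : ∀ t : ℝ, 0 ≤ t → ∃ h : U t ∈ A.domain,
    HasDerivWithinAt U (A ⟨U t, h⟩) (Ici 0) t

/-- The stationary solutions of `U' = A U`: the states `W` whose constant trajectory is a
solution. -/
def stationarySolutions (A : E →ₗ.[ℂ] E) : Set E :=
  {W | IsClassicalSolution A W fun _ => W}

end Unbounded

/-! ## The stationary profile -/

namespace Bar

variable (P : Bar)

/-- The profile `ζ¹` on `[L₁, L₂]`. -/
def zeta1 (x : ℝ) : ℝ := (P.L₂ - P.L₁ - P.L₃) / (P.L₁ * P.L₃) * x + 1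

/-- The profile `ζ²` on `[0, L₁] ∪ [L₂, L₃]`. -/
def zeta2 (x : ℝ) : ℝ :=
  if x ≤ P.L₁ then (P.L₂ - P.L₁) / (P.L₁ * P.L₃) * x
  else (P.L₂ - P.L₁) / (P.L₁ * P.L₃) * x - (P.L₂ - P.L₁) / P.L₁

/-- The constant profile `ζ³` on `[L₁, L₂]`. -/
def zeta3 : ℝ :=
  (P.a * (P.L₂ - P.L₁ - P.L₃) - P.b * (P.L₂ - P.L₁)) / (P.m * P.L₁ * P.L₃)

end Bar

end Transmission

end

namespace Transmission

/-! ## Primitives of integrable functions -/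

/-! At a frequency `s ≠ 0` the equation `(is - A) U = F` is a linear boundary value problem for
ordinary differential equations with constant coefficients. It has as many boundary conditions as
free initial values, so uniqueness gives solvability, with a bound on the solution. No compactness
of the resolvent is needed.

Uniqueness (`transmission_eq_zero`) is an energy argument. In an elastic part the flux `Re(b v_x
conj(is v))` is constant, and it vanishes at the clamped end, so no energy passes through `L₁` or
`L₂`. In the thermoelastic part, `Re((a u_x - m θ) conj(is u)) + k² Re(θ_x conj θ)` has derivative
`k² |θ_x|²` and vanishes at both ends; hence `θ_x = 0`. The heat equation then gives `θ + m u_x =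
0`, so `u_xx = 0`, and the momentum equation gives `u = 0` and thus `θ = 0`. The elastic parts now
have zero Cauchy data at the interfaces and are at rest as well.

Existence (`Bar.exists_isHarmonicSolution`) is by shooting. A forcing `g` that is merely `L²` is
replaced by its continuous primitive `G`: if `z' = M (z + G)`, then `y = z + G` satisfies `y' = M y
+ g`, while `z` is classically differentiable. Variation of constants gives a bounded particular
solution. Its boundary defect is removed by a homogeneous solution, which exists because the defect
map `Bar.homogeneousDefect` is injective between spaces of equal finite dimension. The sup bounds on
the solution then become an energy bound (`exists_resolvent_solution`).

At frequency `0` a kernel element has constant `θ`, by insulation, and piecewise affine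
displacements. Balance of forces at both interfaces gives the two elastic parts the same slope, and
this slope determines everything else (`kernel_subset_span`). Since the resulting profile is
nonzero, `0` is an eigenvalue. A constant trajectory has derivative `0`, so it solves the Cauchy
problem exactly when its value lies in the kernel.

`IsPrimitiveOn` links the two languages: weak derivatives of `L²` classes on one side and pointwise
functions on closed intervals on the other. -/

/-- `c` is a primitive of the integrable function `g` on `[α, β]`. -/
def IsPrimitiveOn (c g : ℝ → ℂ) (α β : ℝ) : Prop :=
  IntervalIntegrable g volume α β ∧
    ∀ x ∈ Icc α β, ∀ y ∈ Icc α β, c y - c x = ∫ t in x..y, g t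

/-- Integration by parts for absolutely continuous functions: the primitive of `g` is absolutely
continuous with derivative `g` almost everywhere, and the boundary terms vanish with `φ`. -/
lemma integral_deriv_mul_primitive {α β : ℝ} {g φ : ℝ → ℝ} (hg : IntervalIntegrable g volume α β)
    (hφ : ContDiff ℝ ∞ φ) (hα : φ α = 0) (hβ : φ β = 0) :
    ∫ x in α..β, deriv φ x * ∫ t in α..x, g t = -∫ x in α..β, φ x * g x := by
  have h1 : AbsolutelyContinuousOnInterval φ α β :=
    (hφ.of_le (by simp)).contDiffOn.absolutelyContinuousOnInterval
  have h2 := hg.absolutelyContinuousOnInterval_intervalIntegral (c := α) (by simp)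
  have h3 := h1.integral_mul_deriv_eq_deriv_mul h2
  rw [hα, hβ] at h3
  have h4 : ∫ x in α..β, φ x * deriv (fun x => ∫ t in α..x, g t) x
      = ∫ x in α..β, φ x * g x := by
    refine intervalIntegral.integral_congr_ae ?_
    filter_upwards [hg.ae_hasDerivAt_integral] with x hx hx'
    rw [(hx (uIoc_subset_uIcc hx') α (by simp)).deriv]
  rw [← h4, h3]
  ring

namespace IsPrimitiveOn

variable {c d g h : ℝ → ℂ} {α β : ℝ}

lemma intervalIntegrable (hc : IsPrimitiveOn c g α β) {x y : ℝ} (hx : x ∈ Icc α β)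
    (hy : y ∈ Icc α β) : IntervalIntegrable g volume x y := by
  refine hc.1.mono_set ?_
  rw [uIcc_of_le (hx.1.trans hx.2)]
  exact uIcc_subset_Icc hx hy

lemma integral_deriv_smul (hc : IsPrimitiveOn c g α β) (hab : α < β) {φ : ℝ → ℝ}
    (hφ : ContDiff ℝ ∞ φ) (hα : φ α = 0) (hβ : φ β = 0) :
    ∫ x in Ioo α β, deriv φ x • c x = -∫ x in Ioo α β, φ x • g x := by
  obtain ⟨hg, hc⟩ := hc
  have hα' : α ∈ Icc α β := ⟨le_rfl, hab.le⟩
  have hβ' : β ∈ Icc α β := ⟨hab.le, le_rfl⟩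
  have hφ' : Continuous (deriv φ) := hφ.continuous_deriv (by simp)
  rw [← integral_Ioc_eq_integral_Ioo, ← integral_Ioc_eq_integral_Ioo,
    ← intervalIntegral.integral_of_le hab.le, ← intervalIntegral.integral_of_le hab.le]
  -- The constant `c α` contributes nothing, because `φ'` has integral zero; what remains is the
  -- primitive that starts at `α`.
  have e0 : ∫ x in α..β, deriv φ x • c x
      = ∫ x in α..β, (deriv φ x • c α + deriv φ x • ∫ t in α..x, g t) := by
    refine intervalIntegral.integral_congr fun x hx => ?_
    rw [uIcc_of_le hab.le] at hx
    rw [← hc α hα' x hx, ← smul_add]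
    congr 1
    ring
  have hP : ContinuousOn (fun x => ∫ t in α..x, g t) (uIcc α β) :=
    intervalIntegral.continuousOn_primitive_interval' hg (by simp)
  have e1 : ∫ x in α..β, deriv φ x • c α = 0 := by
    rw [intervalIntegral.integral_smul_const, intervalIntegral.integral_deriv_eq_sub
      (fun x _ => (hφ.differentiable (by simp)) x) (hφ'.intervalIntegrable _ _), hα, hβ]
    simp
  have hi : IntervalIntegrable (fun x => deriv φ x • ∫ t in α..x, g t) volume α β :=
    (hφ'.continuousOn.smul hP).intervalIntegrable
  have hi' : IntervalIntegrable (fun x => φ x • g x) volume α β :=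
    hg.continuousOn_smul hφ.continuous.continuousOn
  have hi0 : IntervalIntegrable (fun x => deriv φ x • c α) volume α β :=
    (hφ'.smul continuous_const).intervalIntegrable _ _
  rw [e0, intervalIntegral.integral_add hi0 hi, e1, zero_add]
  -- The integration by parts is available for real functions, so it is applied to the real and the
  -- imaginary part, both seen as real functionals `T`.
  have key : ∀ T : ℂ →L[ℝ] ℝ, T (∫ x in α..β, deriv φ x • ∫ t in α..x, g t)
      = T (-∫ x in α..β, φ x • g x) := by
    intro T
    have hgT : IntervalIntegrable (fun x => T (g x)) volume α β :=
      ⟨T.integrable_comp hg.1, T.integrable_comp hg.2⟩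
    rw [map_neg, ← T.intervalIntegral_comp_comm hi, ← T.intervalIntegral_comp_comm hi']
    simp only [map_smul, smul_eq_mul]
    rw [← integral_deriv_mul_primitive hgT hφ hα hβ]
    refine intervalIntegral.integral_congr fun x hx => ?_
    rw [T.intervalIntegral_comp_comm]
    refine hg.mono_set ?_
    exact uIcc_subset_uIcc_left hx
  exact Complex.ext (key Complex.reCLM) (key Complex.imCLM)

lemma continuousOn (hc : IsPrimitiveOn c g α β) : ContinuousOn c (Icc α β) := by
  rcases lt_or_ge β α with h | h
  · simp [Icc_eq_empty (not_le.2 h)]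
  have h1 : ContinuousOn (fun x => ∫ t in α..x, g t) (uIcc α β) :=
    intervalIntegral.continuousOn_primitive_interval' hc.1 (by simp)
  rw [uIcc_of_le h] at h1
  refine (h1.add (continuousOn_const (c := c α))).congr fun x hx => ?_
  change c x = (∫ t in α..x, g t) + c α
  rw [← hc.2 α ⟨le_rfl, h⟩ x hx]
  ring

lemma add (hc : IsPrimitiveOn c g α β) (hd : IsPrimitiveOn d h α β) :
    IsPrimitiveOn (fun x => c x + d x) (fun x => g x + h x) α β := by
  refine ⟨hc.1.add hd.1, fun x hx y hy => ?_⟩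
  rw [intervalIntegral.integral_add (hc.intervalIntegrable hx hy) (hd.intervalIntegrable hx hy),
    ← hc.2 x hx y hy, ← hd.2 x hx y hy]
  ring

lemma congr_ae (hc : IsPrimitiveOn c g α β) (hβ : α ≤ β)
    (hgh : ∀ᵐ x ∂volume.restrict (Ioo α β), g x = h x) :
    IsPrimitiveOn c h α β := by
  have hae : ∀ᵐ x ∂volume.restrict (Icc α β), g x = h x := by
    rwa [← restrict_Ioo_eq_restrict_Icc]
  refine ⟨hc.1.congr_ae ?_, fun x hx y hy => ?_⟩
  · rw [uIoc_of_le hβ]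
    exact ae_mono (Measure.restrict_mono Ioc_subset_Icc_self le_rfl) hae
  · rw [hc.2 x hx y hy]
    refine intervalIntegral.integral_congr_ae_restrict ?_
    exact ae_mono (Measure.restrict_mono (uIoc_subset_uIcc.trans (uIcc_subset_Icc hx hy)) le_rfl)
      hae

lemma congr_left (hc : IsPrimitiveOn c g α β) (hcd : ∀ x ∈ Icc α β, d x = c x) :
    IsPrimitiveOn d g α β :=
  ⟨hc.1, fun x hx y hy => by rw [hcd x hx, hcd y hy, hc.2 x hx y hy]⟩

lemma of_hasDerivAt (hc : ∀ x, HasDerivAt c (g x) x) (hg : Continuous g) :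
    IsPrimitiveOn c g α β :=
  ⟨hg.intervalIntegrable _ _, fun _ _ _ _ => (intervalIntegral.integral_eq_sub_of_hasDerivAt
    (fun z _ => hc z) (hg.intervalIntegrable _ _)).symm⟩

lemma hasDerivWithinAt (hc : IsPrimitiveOn c g α β) (hg : ContinuousOn g (Icc α β)) {x : ℝ}
    (hab : α < β) (hx : x ∈ Icc α β) : HasDerivWithinAt c (g x) (Icc α β) x := by
  have : Fact (x ∈ Icc α β) := ⟨hx⟩
  have hα' : α ∈ Icc α β := ⟨le_rfl, hab.le⟩
  have h1 : HasDerivWithinAt (fun u => ∫ t in α..u, g t) (g x) (Icc α β) x :=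
    intervalIntegral.integral_hasDerivWithinAt_right (hc.intervalIntegrable hα' hx)
      (hg.stronglyMeasurableAtFilter_nhdsWithin measurableSet_Icc x) (hg x hx)
  refine (h1.add_const (c α)).congr (fun y hy => ?_) ?_
  · change c y = (∫ t in α..y, g t) + c α
    rw [← hc.2 α hα' y hy]; ring
  · change c x = (∫ t in α..x, g t) + c α
    rw [← hc.2 α hα' x hx]; ring

end IsPrimitiveOn

/-! ## Primitives and weak derivatives -/

lemma L2.integrableOn {Ω : Set ℝ} (hΩ : volume Ω ≠ ⊤) (f : L2 Ω) :
    IntegrableOn (f : ℝ → ℂ) Ω volume := by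
  have : IsFiniteMeasure (volume.restrict Ω) := isFiniteMeasure_restrict.2 hΩ
  exact (Lp.memLp f).integrable (by norm_num)

lemma L2.intervalIntegrable {Ω : Set ℝ} {α β : ℝ} (hab : α ≤ β) (hs : Ioo α β ⊆ Ω) (f : L2 Ω) :
    IntervalIntegrable (f : ℝ → ℂ) volume α β := by
  rw [intervalIntegrable_iff_integrableOn_Ioo_of_le hab]
  have : IsFiniteMeasure (volume.restrict (Ioo α β)) := by
    rw [isFiniteMeasure_restrict]; simp
  exact ((Lp.memLp f).mono_measure (Measure.restrict_mono hs le_rfl)).integrable (by norm_num)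

lemma setIntegral_eq_of_subset_of_forall_notMem_eq_zero {s t : Set ℝ} {f : ℝ → ℂ} (hst : s ⊆ t)
    (hf : ∀ x, x ∉ s → f x = 0) : ∫ x in t, f x = ∫ x in s, f x := by
  rw [setIntegral_eq_integral_of_forall_compl_eq_zero hf,
    setIntegral_eq_integral_of_forall_compl_eq_zero fun x hx => hf x fun h => hx (hst h)]

/-- The continuous representative of an `H¹` function is a primitive of its weak derivative. -/
lemma IsContRep.isPrimitiveOn {Ω : Set ℝ} {f g : L2 Ω} {c : ℝ → ℂ} (hf : IsContRep f c)
    (h : HasWeakDeriv f g) {α β : ℝ} (hab : α < β) (hs : Ioo α β ⊆ Ω) :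
    IsPrimitiveOn c g α β := by
  have hg := g.intervalIntegrable hab.le hs
  have hcl : Icc α β ⊆ closure Ω := by
    rw [← closure_Ioo hab.ne]
    exact closure_mono hs
  have hcc : ContinuousOn c (Icc α β) := hf.1.mono hcl
  have hP : ContinuousOn (fun x => ∫ t in α..x, g t) (Icc α β) := by
    rw [← uIcc_of_le hab.le]
    exact intervalIntegral.continuousOn_primitive_interval' hg (by simp)
  have hpr : IsPrimitiveOn (fun x => ∫ t in α..x, g t) g α β := by
    refine ⟨hg, fun x hx y hy => ?_⟩
    refine intervalIntegral.integral_interval_sub_left (hg.mono_set ?_) (hg.mono_set ?_)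
    · rw [uIcc_of_le hab.le]; exact uIcc_subset_Icc ⟨le_rfl, hab.le⟩ hy
    · rw [uIcc_of_le hab.le]; exact uIcc_subset_Icc ⟨le_rfl, hab.le⟩ hx
  have hfc : (f : ℝ → ℂ) =ᵐ[volume.restrict (Ioo α β)] c :=
    ae_mono (Measure.restrict_mono hs le_rfl) hf.2
  have hcont : ContinuousOn (fun x => c x - ∫ t in α..x, g t) (Icc α β) := hcc.sub hP
  -- The difference of `c` and the primitive of `g` has zero weak derivative, so it is almost
  -- everywhere constant; continuity then makes it constant on the whole closed interval.
  obtain ⟨z, hz⟩ := ae_const_of_integral_deriv_smul_eq_zero hab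
    (f := fun x => c x - ∫ t in α..x, g t)
    ((hcont.mono Ioo_subset_Icc_self).locallyIntegrableOn measurableSet_Ioo) (by
      intro φ hφ hc hsφ
      have hφ' : Continuous (deriv φ) := hφ.continuous_deriv (by simp)
      have hz0 : ∀ x, x ∉ Ioo α β → φ x = 0 := fun x hx =>
        image_eq_zero_of_notMem_tsupport fun hx' => hx (hsφ hx')
      have hz1 : ∀ x, x ∉ Ioo α β → deriv φ x = 0 := fun x hx =>
        image_eq_zero_of_notMem_tsupport fun hx' => hx (hsφ (tsupport_deriv_subset hx'))
      have h1 := h φ hφ hc (hsφ.trans hs)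
      have h2 := hpr.integral_deriv_smul hab hφ (hz0 α (by simp)) (hz0 β (by simp))
      have r1 : ∫ x in Ω, deriv φ x • f x = ∫ x in Ioo α β, deriv φ x • f x :=
        setIntegral_eq_of_subset_of_forall_notMem_eq_zero hs fun x hx => by simp [hz1 x hx]
      have r2 : ∫ x in Ω, φ x • g x = ∫ x in Ioo α β, φ x • g x :=
        setIntegral_eq_of_subset_of_forall_notMem_eq_zero hs fun x hx => by simp [hz0 x hx]
      have r3 : ∫ x in Ioo α β, deriv φ x • f x = ∫ x in Ioo α β, deriv φ x • c x := by
        refine integral_congr_ae ?_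
        filter_upwards [hfc] with x hx
        rw [hx]
      rw [← setIntegral_eq_integral_of_forall_compl_eq_zero (s := Ioo α β)
        (fun x hx => by simp [hz1 x hx])]
      simp_rw [smul_sub]
      have hci : IntegrableOn (fun x => deriv φ x • c x) (Ioo α β) volume :=
        ((hφ'.continuousOn.smul hcc).integrableOn_Icc).mono_set Ioo_subset_Icc_self
      have hPi : IntegrableOn (fun x => deriv φ x • ∫ t in α..x, g t) (Ioo α β) volume :=
        ((hφ'.continuousOn.smul hP).integrableOn_Icc).mono_set Ioo_subset_Icc_self
      rw [integral_sub hci hPi, h2, ← r3, ← r1, ← r2, h1, sub_self])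
  have hae : (fun x => c x - ∫ t in α..x, g t) =ᵐ[volume.restrict (Icc α β)] fun _ => z := by
    rw [← restrict_Ioo_eq_restrict_Icc]
    exact (ae_restrict_iff' measurableSet_Ioo).2 hz
  have heq := Measure.eqOn_Icc_of_ae_eq volume hab.ne hae hcont continuousOn_const
  refine ⟨hg, fun x hx y hy => ?_⟩
  rw [← hpr.2 x hx y hy]
  have ex : c x - ∫ t in α..x, g t = z := heq hx
  have ey : c y - ∫ t in α..y, g t = z := heq hy
  linear_combination ey - ex

lemma hasWeakDeriv_of_isPrimitiveOn {α β : ℝ} (hab : α < β) {f g : L2 (Ioo α β)} {c : ℝ → ℂ}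
    (hf : (f : ℝ → ℂ) =ᵐ[volume.restrict (Ioo α β)] c) (hc : IsPrimitiveOn c g α β) :
    HasWeakDeriv f g := by
  intro φ hφ _ hs
  have hz0 : ∀ x, x ∉ Ioo α β → φ x = 0 := fun x hx =>
    image_eq_zero_of_notMem_tsupport fun hx' => hx (hs hx')
  rw [← hc.integral_deriv_smul hab hφ (hz0 α (by simp)) (hz0 β (by simp))]
  refine integral_congr_ae ?_
  filter_upwards [hf] with x hx
  rw [hx]

/-- A test function supported in the open union vanishes at all four endpoints, so one can integrate
by parts on each interval separately. For this reason `c` may jump from one interval to the other.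
-/
lemma hasWeakDeriv_of_isPrimitiveOn_union {α β γ δ : ℝ} (hab : α < β) (hbc : β ≤ γ) (hcd : γ < δ)
    {f g : L2 (Ioo α β ∪ Ioo γ δ)} {c : ℝ → ℂ}
    (hf : (f : ℝ → ℂ) =ᵐ[volume.restrict (Ioo α β ∪ Ioo γ δ)] c) (h₁ : IsPrimitiveOn c g α β)
    (h₂ : IsPrimitiveOn c g γ δ) : HasWeakDeriv f g := by
  intro φ hφ hφc hs
  have hφ' : Continuous (deriv φ) := hφ.continuous_deriv (by simp)
  have hz0 : ∀ x, x ∉ Ioo α β ∪ Ioo γ δ → φ x = 0 := fun x hx =>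
    image_eq_zero_of_notMem_tsupport fun hx' => hx (hs hx')
  have hα : φ α = 0 := hz0 α (by rintro (h | h) <;> linarith [h.1, h.2])
  have hβ : φ β = 0 := hz0 β (by rintro (h | h) <;> linarith [h.1, h.2])
  have hγ : φ γ = 0 := hz0 γ (by rintro (h | h) <;> linarith [h.1, h.2])
  have hδ : φ δ = 0 := hz0 δ (by rintro (h | h) <;> linarith [h.1, h.2])
  have hdisj : Disjoint (Ioo α β) (Ioo γ δ) := by
    rw [Set.disjoint_left]
    intro x h h'
    linarith [h.2, h'.1]
  have i1 := integrable_test_smul f hφ' hφc.deriv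
  have i2 := integrable_test_smul g hφ.continuous hφc
  have key : ∀ s ⊆ Ioo α β ∪ Ioo γ δ, ∫ x in s, deriv φ x • f x = ∫ x in s, deriv φ x • c x := by
    intro s hs
    refine integral_congr_ae ?_
    filter_upwards [ae_mono (Measure.restrict_mono hs le_rfl) hf] with x hx
    rw [hx]
  rw [setIntegral_union hdisj measurableSet_Ioo (IntegrableOn.mono_set i1 subset_union_left)
    (IntegrableOn.mono_set i1 subset_union_right), setIntegral_union hdisj measurableSet_Ioo
    (IntegrableOn.mono_set i2 subset_union_left) (IntegrableOn.mono_set i2 subset_union_right),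
    key _ subset_union_left, key _ subset_union_right, h₁.integral_deriv_smul hab hφ hα hβ,
    h₂.integral_deriv_smul hcd hφ hγ hδ]
  ring

/-! ## Estimates in `L²` of a bounded set -/

/-- Cauchy-Schwarz against the constant function `1`. -/
lemma L2.integral_norm_le {Ω : Set ℝ} (hΩ : volume Ω ≠ ⊤) (g : L2 Ω) :
    ∫ x in Ω, ‖g x‖ ≤ √(volume.real Ω) * ‖g‖ := by
  have h := eLpNorm_le_eLpNorm_mul_rpow_measure_univ (μ := volume.restrict Ω) (p := 1) (q := 2)
    (by norm_num) (Lp.memLp g).1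
  rw [integral_norm_eq_lintegral_enorm (Lp.memLp g).1, ← eLpNorm_one_eq_lintegral_enorm,
    Lp.norm_def, Real.sqrt_eq_rpow, measureReal_def, ENNReal.toReal_rpow, ← ENNReal.toReal_mul,
    mul_comm]
  refine ENNReal.toReal_mono (ENNReal.mul_ne_top (Lp.memLp g).2.ne ?_) ?_
  · exact ENNReal.rpow_ne_top_of_nonneg (by norm_num) hΩ
  · convert! h using 2
    rw [Measure.restrict_apply_univ]
    norm_num

lemma L2.norm_integral_le {Ω : Set ℝ} (hΩ : volume Ω ≠ ⊤) (g : L2 Ω) {α β x y : ℝ}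
    (hs : Ioo α β ⊆ Ω) (hx : x ∈ Icc α β) (hy : y ∈ Icc α β) :
    ‖∫ t in x..y, g t‖ ≤ √(volume.real Ω) * ‖g‖ := by
  refine (intervalIntegral.norm_integral_le_integral_norm_uIoc).trans ?_
  refine le_trans ?_ (g.integral_norm_le hΩ)
  have h1 : uIoc x y ≤ᵐ[volume] Ω :=
    (LE.le.eventuallyLE (uIoc_subset_uIcc.trans (uIcc_subset_Icc hx hy))).trans
      (Ioo_ae_eq_Icc.symm.le.trans hs.eventuallyLE)
  exact setIntegral_mono_set (g.integrableOn hΩ).norm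
    (Eventually.of_forall fun _ => norm_nonneg _) h1

lemma IsContRep.norm_le {Ω : Set ℝ} (hΩ : volume Ω ≠ ⊤) (hm : MeasurableSet Ω) {f : L2 Ω}
    {c : ℝ → ℂ} (hf : IsContRep f c) {K : ℝ} (hK : 0 ≤ K) (h : ∀ x ∈ Ω, ‖c x‖ ≤ K) :
    ‖f‖ ≤ √(volume.real Ω) * K := by
  have : IsFiniteMeasure (volume.restrict Ω) := isFiniteMeasure_restrict.2 hΩ
  have h1 := Lp.norm_le_of_ae_bound (f := f) hK (by
    filter_upwards [hf.2, ae_restrict_mem hm] with x hx hx'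
    rw [hx]; exact h x hx')
  convert! h1 using 2
  simp [Real.sqrt_eq_rpow, measureUnivNNReal, measureReal_def, ENNReal.coe_toNNReal_eq_toReal]

/-- This leads from a pointwise solution of the differential equations back to elements of `L²`. -/
lemma exists_isContRep {Ω : Set ℝ} (hb : Bornology.IsBounded Ω) {c : ℝ → ℂ}
    (hc : ContinuousOn c (closure Ω)) : ∃ f : L2 Ω, IsContRep f c := by
  have hK : IsCompact (closure Ω) := hb.isCompact_closure
  have : IsFiniteMeasure (volume.restrict (closure Ω)) :=
    isFiniteMeasure_restrict.2 hK.measure_lt_top.ne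
  obtain ⟨K, hK'⟩ := hK.exists_bound_of_continuousOn hc
  have h1 : MemLp c 2 (volume.restrict (closure Ω)) :=
    MemLp.of_bound (hc.aestronglyMeasurable hK.measurableSet) K
      ((ae_restrict_iff' hK.measurableSet).2 (Eventually.of_forall hK'))
  have h2 := h1.mono_measure (Measure.restrict_mono (subset_closure (s := Ω)) le_rfl)
  exact ⟨h2.toLp c, hc, h2.coeFn_toLp⟩

/-- An `L²` function extended by zero, integrated from a base point. -/
noncomputable def L2.primitive {Ω : Set ℝ} (g : L2 Ω) (x₀ x : ℝ) : ℂ :=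
  ∫ t in x₀..x, Ω.indicator g t

lemma L2.integrable_indicator {Ω : Set ℝ} (hΩ : volume Ω ≠ ⊤) (hm : MeasurableSet Ω) (g : L2 Ω) :
    Integrable (Ω.indicator (g : ℝ → ℂ)) volume :=
  (integrable_indicator_iff hm).2 (g.integrableOn hΩ)

lemma L2.continuous_primitive {Ω : Set ℝ} (hΩ : volume Ω ≠ ⊤) (hm : MeasurableSet Ω) (g : L2 Ω)
    (x₀ : ℝ) : Continuous (g.primitive x₀) :=
  intervalIntegral.continuous_primitive
    (fun _ _ => (g.integrable_indicator hΩ hm).intervalIntegrable) x₀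

lemma L2.isPrimitiveOn_primitive {Ω : Set ℝ} (hΩ : volume Ω ≠ ⊤) (hm : MeasurableSet Ω) (g : L2 Ω)
    (x₀ : ℝ) {α β : ℝ} (hab : α ≤ β) (hs : Ioo α β ⊆ Ω) :
    IsPrimitiveOn (g.primitive x₀) g α β := by
  have hi : ∀ x y, IntervalIntegrable (Ω.indicator (g : ℝ → ℂ)) volume x y :=
    fun _ _ => (g.integrable_indicator hΩ hm).intervalIntegrable
  have h : IsPrimitiveOn (g.primitive x₀) (Ω.indicator g) α β :=
    ⟨hi _ _, fun x _ y _ => intervalIntegral.integral_interval_sub_left (hi _ _) (hi _ _)⟩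
  refine h.congr_ae hab ?_
  filter_upwards [ae_restrict_mem measurableSet_Ioo] with x hx
  rw [indicator_of_mem (hs hx)]

lemma L2.norm_primitive_le {Ω : Set ℝ} (hΩ : volume Ω ≠ ⊤) (hm : MeasurableSet Ω) (g : L2 Ω)
    (x₀ x : ℝ) : ‖g.primitive x₀ x‖ ≤ √(volume.real Ω) * ‖g‖ := by
  refine (intervalIntegral.norm_integral_le_integral_norm_uIoc).trans ?_
  refine le_trans ?_ (g.integral_norm_le hΩ)
  rw [← integral_indicator hm]
  simp_rw [norm_indicator_eq_indicator_norm]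
  exact setIntegral_le_integral ((integrable_indicator_iff hm).2 (g.integrableOn hΩ).norm)
    (Eventually.of_forall fun _ => indicator_nonneg (fun _ _ => norm_nonneg _) _)

/-! ## Linear differential equations with constant coefficients -/

section ODE

open NormedSpace

variable {E : Type*} [NormedAddCommGroup E] [NormedSpace ℝ E] [CompleteSpace E]

/-- The propagator `exp (x M)`. -/
noncomputable def propagator (M : E →L[ℝ] E) (x : ℝ) : E →L[ℝ] E := exp (x • M)

lemma hasDerivAt_propagator (M : E →L[ℝ] E) (x : ℝ) :
    HasDerivAt (propagator M) (M * propagator M x) x :=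
  hasDerivAt_exp_smul_const' M x

lemma continuous_propagator (M : E →L[ℝ] E) : Continuous (propagator M) :=
  continuous_iff_continuousAt.2 fun x => (hasDerivAt_propagator M x).continuousAt

lemma propagator_mul_neg (M : E →L[ℝ] E) (x : ℝ) : propagator M x * propagator M (-x) = 1 := by
  let _ : NormedAlgebra ℚ (E →L[ℝ] E) := NormedAlgebra.restrictScalars ℚ ℝ (E →L[ℝ] E)
  rw [propagator, propagator, neg_smul, ← exp_add_of_commute (Commute.neg_right (Commute.refl _)),
    add_neg_cancel, exp_zero]

lemma hasDerivAt_propagator_apply (M : E →L[ℝ] E) (x₀ : ℝ) (y : E) (x : ℝ) :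
    HasDerivAt (fun x => propagator M (x - x₀) y) (M (propagator M (x - x₀) y)) x := by
  have h := (hasDerivAt_propagator M (x - x₀)).scomp x ((hasDerivAt_id x).sub_const x₀)
  rw [one_smul] at h
  exact h.clm_apply (hasDerivAt_const x y) |>.congr_deriv (by simp)

lemma exists_bound_propagator (M : E →L[ℝ] E) (T : ℝ) :
    ∃ K : ℝ, 0 ≤ K ∧ ∀ x, |x| ≤ T → ‖propagator M x‖ ≤ K := by
  obtain ⟨K, hK⟩ := (isCompact_Icc (a := -T) (b := T)).exists_bound_of_continuousOn
    (continuous_propagator M).continuousOn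
  exact ⟨|K|, abs_nonneg K, fun x hx => (hK x (abs_le.1 hx)).trans (le_abs_self K)⟩

/-- The inhomogeneous equation `z' = M (z + G)`, `z(x₀) = 0` has a solution that is bounded by
the right-hand side. -/
lemma exists_bounded_solution (M : E →L[ℝ] E) (x₀ T : ℝ) :
    ∃ C : ℝ, 0 ≤ C ∧ ∀ (G : ℝ → E) (B : ℝ), Continuous G → (∀ x, ‖G x‖ ≤ B) →
      ∃ z : ℝ → E, z x₀ = 0 ∧ (∀ x, HasDerivAt z (M (z x + G x)) x) ∧
        ∀ x, |x - x₀| ≤ T → ‖z x‖ ≤ C * B := by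
  obtain ⟨K, hK0, hK'⟩ := exists_bound_propagator M T
  -- One factor `K` bounds the outer propagator and the other the one under the integral; `|T|`
  -- bounds the length of integration, since no sign of `T` is assumed.
  refine ⟨K * ((K * ‖M‖) * |T|), by positivity, fun G B hG hB => ?_⟩
  have hB0 : 0 ≤ B := (norm_nonneg _).trans (hB 0)
  -- Variation of constants: the solution is `exp((x - x₀) M)` applied to the integral of `w`.
  set w : ℝ → E := fun s => propagator M (-(s - x₀)) (M (G s)) with hw
  have hwc : Continuous w :=
    ((continuous_propagator M).comp (by fun_prop)).clm_apply (M.continuous.comp hG)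
  refine ⟨fun x => propagator M (x - x₀) (∫ s in x₀..x, w s), by simp, fun x => ?_, fun x hx => ?_⟩
  · have h1 := (hasDerivAt_propagator M (x - x₀)).scomp x ((hasDerivAt_id x).sub_const x₀)
    rw [one_smul] at h1
    have h2 : HasDerivAt (fun x => ∫ s in x₀..x, w s) (w x) x :=
      intervalIntegral.integral_hasDerivAt_right (hwc.intervalIntegrable _ _)
        (hwc.stronglyMeasurableAtFilter _ _) hwc.continuousAt
    refine (h1.clm_apply h2).congr_deriv ?_
    have h3 : propagator M (x - x₀) (w x) = M (G x) := by
      have := congrArg (fun S : E →L[ℝ] E => S (M (G x))) (propagator_mul_neg M (x - x₀))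
      exact this
    simp only [Function.comp_apply, id_eq, h3, map_add]
    rfl
  · have h1 : ‖∫ s in x₀..x, w s‖ ≤ (K * (‖M‖ * B)) * |x - x₀| := by
      refine intervalIntegral.norm_integral_le_of_norm_le_const fun s hs => ?_
      refine (ContinuousLinearMap.le_opNorm _ _).trans ?_
      have hs' : |-(s - x₀)| ≤ T := by
        rw [abs_neg]
        exact (abs_sub_left_of_mem_uIcc (uIoc_subset_uIcc hs)).trans hx
      gcongr
      · exact hK' _ hs'
      · exact (M.le_opNorm _).trans (by gcongr; exact hB s)
    calc _ ≤ ‖propagator M (x - x₀)‖ * ‖∫ s in x₀..x, w s‖ := ContinuousLinearMap.le_opNorm _ _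
      _ ≤ K * ((K * (‖M‖ * B)) * |T|) := by
        gcongr
        · exact hK' _ hx
        · refine h1.trans ?_
          exact mul_le_mul_of_nonneg_left (hx.trans (le_abs_self T)) (by positivity)
      _ = _ := by ring

end ODE

lemma propagator_zero {E : Type*} [NormedAddCommGroup E] [NormedSpace ℝ E] (M : E →L[ℝ] E) :
    propagator M 0 = 1 := by
  simp [propagator]

/-! ## The homogeneous boundary value problem -/

lemma eq_of_hasDerivWithinAt_zero {F : Type*} [NormedAddCommGroup F] [NormedSpace ℝ F] {f : ℝ → F}
    {α β : ℝ} (hf : ∀ x ∈ Icc α β, HasDerivWithinAt f 0 (Icc α β) x) {x y : ℝ}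
    (hx : x ∈ Icc α β) (hy : y ∈ Icc α β) : f x = f y := by
  have h := (convex_Icc α β).norm_image_sub_le_of_norm_hasDerivWithin_le (C := 0) hf
    (fun _ _ => by simp) hy hx
  rw [zero_mul, norm_le_zero_iff, sub_eq_zero] at h
  exact h

lemma hasDerivWithinAt_re_mul_star {f g : ℝ → ℂ} {f' g' : ℂ} {s : Set ℝ} {x : ℝ}
    (hf : HasDerivWithinAt f f' s x) (hg : HasDerivWithinAt g g' s x) :
    HasDerivWithinAt (fun x => (f x * star (g x)).re) (f' * star (g x) + f x * star g').re s x :=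
  Complex.reCLM.hasFDerivAt.comp_hasDerivWithinAt x (hf.mul hg.star)

/-- The energy flux through an elastic bar in harmonic motion is constant. -/
lemma elastic_flux_eq {b s α β : ℝ} {v w w' : ℝ → ℂ}
    (hv : ∀ x ∈ Icc α β, HasDerivWithinAt v (w x) (Icc α β) x)
    (hw : ∀ x ∈ Icc α β, HasDerivWithinAt w (w' x) (Icc α β) x)
    (h : ∀ x ∈ Icc α β, (b : ℂ) * w' x = -(s : ℂ) ^ 2 * v x) {x y : ℝ}
    (hx : x ∈ Icc α β) (hy : y ∈ Icc α β) :
    ((b : ℂ) * w x * star (Complex.I * s * v x)).re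
      = ((b : ℂ) * w y * star (Complex.I * s * v y)).re := by
  refine eq_of_hasDerivWithinAt_zero (f := fun x => ((b : ℂ) * w x * star (Complex.I * s * v x)).re)
    (fun x hx => ?_) hx hy
  refine (hasDerivWithinAt_re_mul_star ((hw x hx).const_mul (b : ℂ))
    ((hv x hx).const_mul (Complex.I * s))).congr_deriv ?_
  rw [h x hx]
  simp [pow_two]
  ring

/-- An elastic bar in harmonic motion that is free and at rest at one point is at rest. -/
lemma elastic_eq_zero {b s α β : ℝ} (hb : 0 < b) (hs : s ≠ 0) {v w w' : ℝ → ℂ}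
    (hv : ∀ x ∈ Icc α β, HasDerivWithinAt v (w x) (Icc α β) x)
    (hw : ∀ x ∈ Icc α β, HasDerivWithinAt w (w' x) (Icc α β) x)
    (h : ∀ x ∈ Icc α β, (b : ℂ) * w' x = -(s : ℂ) ^ 2 * v x) {x₀ : ℝ} (hx₀ : x₀ ∈ Icc α β)
    (hv₀ : v x₀ = 0) (hw₀ : w x₀ = 0) : ∀ x ∈ Icc α β, v x = 0 ∧ w x = 0 := by
  intro x hx
  -- The energy density `b |w|² + s² |v|²` is constant in `x` and vanishes at `x₀`; both of its
  -- terms are nonnegative.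
  have key := eq_of_hasDerivWithinAt_zero
    (f := fun x => ((b : ℂ) * w x * star (w x)).re + ((s : ℂ) ^ 2 * v x * star (v x)).re)
    (fun x hx => ((hasDerivWithinAt_re_mul_star ((hw x hx).const_mul (b : ℂ)) (hw x hx)).add
      (hasDerivWithinAt_re_mul_star ((hv x hx).const_mul ((s : ℂ) ^ 2)) (hv x hx))).congr_deriv (by
        have e : w' x = -((s : ℂ) ^ 2 / b) * v x := by
          have : (b : ℂ) ≠ 0 := by exact_mod_cast hb.ne'
          have := h x hx
          field_simp
          linear_combination this
        have e' : ((s : ℂ) ^ 2 / b) = ((s ^ 2 / b : ℝ) : ℂ) := by push_cast; ring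
        rw [h x hx, e, e', ← Complex.ofReal_pow]
        simp only [Complex.star_def, Complex.add_re, Complex.mul_re, Complex.mul_im,
          Complex.neg_re, Complex.neg_im, Complex.conj_re, Complex.conj_im, Complex.ofReal_re,
          Complex.ofReal_im]
        field_simp
        ring)) hx hx₀
  simp only [hv₀, hw₀, mul_zero, zero_mul, Complex.zero_re, add_zero] at key
  have e1 : ((b : ℂ) * w x * star (w x)).re = b * Complex.normSq (w x) := by
    rw [mul_assoc, Complex.star_def, Complex.mul_conj, ← Complex.ofReal_mul, Complex.ofReal_re]
  have e2 : ((s : ℂ) ^ 2 * v x * star (v x)).re = s ^ 2 * Complex.normSq (v x) := by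
    rw [mul_assoc, Complex.star_def, Complex.mul_conj, ← Complex.ofReal_pow, ← Complex.ofReal_mul,
      Complex.ofReal_re]
  rw [e1, e2] at key
  have p1 := mul_nonneg hb.le (Complex.normSq_nonneg (w x))
  have p2 := mul_nonneg (sq_nonneg s) (Complex.normSq_nonneg (v x))
  have q1 : b * Complex.normSq (w x) = 0 := by linarith
  have q2 : s ^ 2 * Complex.normSq (v x) = 0 := by linarith
  simp only [mul_eq_zero, hb.ne', pow_eq_zero_iff, ne_eq, OfNat.ofNat_ne_zero, not_false_eq_true,
    hs, false_or, Complex.normSq_eq_zero] at q1 q2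
  exact ⟨q2, q1⟩

/-- An insulated thermoelastic bar in harmonic motion through whose ends no energy flows is at
rest. -/
lemma thermoelastic_eq_zero {a m k s α β : ℝ} (hm : m ≠ 0) (hk : k ≠ 0) (hs : s ≠ 0)
    (hab : α < β) {u p p' t q q' : ℝ → ℂ}
    (hu : ∀ x ∈ Icc α β, HasDerivWithinAt u (p x) (Icc α β) x)
    (hp : ∀ x ∈ Icc α β, HasDerivWithinAt p (p' x) (Icc α β) x)
    (ht : ∀ x ∈ Icc α β, HasDerivWithinAt t (q x) (Icc α β) x)
    (hq : ∀ x ∈ Icc α β, HasDerivWithinAt q (q' x) (Icc α β) x)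
    (h₁ : ∀ x ∈ Icc α β, (a : ℂ) * p' x = m * q x - (s : ℂ) ^ 2 * u x)
    (h₂ : ∀ x ∈ Icc α β, (k : ℂ) ^ 2 * q' x = Complex.I * s * t x + m * (Complex.I * s * p x))
    (hqα : q α = 0) (hqβ : q β = 0)
    (hα : ((a * p α - m * t α) * star (Complex.I * s * u α)).re = 0)
    (hβ : ((a * p β - m * t β) * star (Complex.I * s * u β)).re = 0) :
    ∀ x ∈ Icc α β, u x = 0 ∧ p x = 0 ∧ t x = 0 ∧ q x = 0 := by
  have hα' : α ∈ Icc α β := ⟨le_rfl, hab.le⟩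
  have hβ' : β ∈ Icc α β := ⟨hab.le, le_rfl⟩
  -- Mechanical power flux plus heat flux. The elastic terms drop out of the real part of the
  -- derivative, the two coupling terms in `m` cancel, and only the thermal dissipation is left.
  set Φ : ℝ → ℝ := fun x => ((a * p x - m * t x) * star (Complex.I * s * u x)).re
    + ((k : ℂ) ^ 2 * q x * star (t x)).re with hΦ
  have hd : ∀ x ∈ Icc α β, HasDerivWithinAt Φ (k ^ 2 * Complex.normSq (q x)) (Icc α β) x := by
    intro x hx
    refine ((hasDerivWithinAt_re_mul_star (((hp x hx).const_mul (a : ℂ)).sub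
      ((ht x hx).const_mul (m : ℂ))) ((hu x hx).const_mul (Complex.I * s))).add
      (hasDerivWithinAt_re_mul_star ((hq x hx).const_mul ((k : ℂ) ^ 2)) (ht x hx))).congr_deriv ?_
    rw [h₁ x hx, h₂ x hx, ← Complex.ofReal_pow, ← Complex.ofReal_pow]
    simp only [Pi.sub_apply, Complex.star_def, Complex.add_re, Complex.add_im, Complex.sub_re, Complex.sub_im,
      Complex.mul_re, Complex.mul_im, Complex.conj_re, Complex.conj_im, Complex.ofReal_re,
      Complex.ofReal_im, Complex.I_re, Complex.I_im, Complex.normSq_apply]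
    ring
  have hmono : MonotoneOn Φ (Icc α β) := by
    refine monotoneOn_of_hasDerivWithinAt_nonneg (f' := fun x => k ^ 2 * Complex.normSq (q x))
      (convex_Icc α β) (fun x hx => (hd x hx).continuousWithinAt)
      (fun x hx => (hd x (interior_subset hx)).mono interior_subset) fun x _ => ?_
    exact mul_nonneg (sq_nonneg k) (Complex.normSq_nonneg _)
  have hΦα : Φ α = 0 := by simp only [hΦ, hα, hqα]; simp
  have hΦβ : Φ β = 0 := by simp only [hΦ, hβ, hqβ]; simp
  -- A monotone function that vanishes at both ends is zero, so its derivative `k² |q|²` is zero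
  -- too.
  have hΦ0 : ∀ x ∈ Icc α β, Φ x = 0 := fun x hx =>
    le_antisymm (hΦβ ▸ hmono hx hβ' hx.2) (hΦα ▸ hmono hα' hx hx.1)
  have huniq := uniqueDiffOn_Icc hab
  have hzero : ∀ {f f' : ℝ → ℂ} {z : ℂ}, (∀ x ∈ Icc α β, HasDerivWithinAt f (f' x) (Icc α β) x) →
      (∀ x ∈ Icc α β, f x = z) → ∀ x ∈ Icc α β, f' x = 0 := by
    intro f f' z hf hz x hx
    have h0 : HasDerivWithinAt f 0 (Icc α β) x :=
      (hasDerivWithinAt_const x (Icc α β) z).congr hz (hz x hx)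
    exact (huniq x hx).eq_deriv _ (hf x hx) h0
  have q0 : ∀ x ∈ Icc α β, q x = 0 := by
    intro x hx
    have h0 : HasDerivWithinAt Φ 0 (Icc α β) x :=
      (hasDerivWithinAt_const x (Icc α β) (0 : ℝ)).congr hΦ0 (hΦ0 x hx)
    have := (huniq x hx).eq_deriv _ (hd x hx) h0
    simpa [hk] using this
  have hsI : Complex.I * (s : ℂ) ≠ 0 := mul_ne_zero Complex.I_ne_zero (by exact_mod_cast hs)
  have hsC : (s : ℂ) ^ 2 ≠ 0 := pow_ne_zero 2 (by exact_mod_cast hs)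
  have hmC : (m : ℂ) ≠ 0 := by exact_mod_cast hm
  -- With `q = 0` the left side of the heat equation vanishes; since `is ≠ 0`, this relation is
  -- left.
  have tp : ∀ x ∈ Icc α β, t x + m * p x = 0 := by
    intro x hx
    have h := h₂ x hx
    rw [hzero hq q0 x hx] at h
    refine (mul_eq_zero.1 (?_ : Complex.I * (s : ℂ) * (t x + m * p x) = 0)).resolve_left hsI
    linear_combination -h
  have p0' : ∀ x ∈ Icc α β, p' x = 0 := by
    intro x hx
    have h := hzero (fun x hx => (ht x hx).add ((hp x hx).const_mul (m : ℂ))) tp x hx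
    rw [q0 x hx, zero_add] at h
    exact (mul_eq_zero.1 h).resolve_left hmC
  have u0 : ∀ x ∈ Icc α β, u x = 0 := by
    intro x hx
    have h := h₁ x hx
    rw [p0' x hx, q0 x hx] at h
    refine (mul_eq_zero.1 (?_ : (s : ℂ) ^ 2 * u x = 0)).resolve_left hsC
    linear_combination h
  have p0 := hzero hu u0
  refine fun x hx => ⟨u0 x hx, p0 x hx, ?_, q0 x hx⟩
  have := tp x hx
  rwa [p0 x hx, mul_zero, add_zero] at this

/-- The transmission problem has no purely imaginary eigenvalues apart from `0`. -/
lemma transmission_eq_zero (P : Bar) {s : ℝ} (hs : s ≠ 0) {u p p' t q q' v w w' : ℝ → ℂ}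
    (hu : ∀ x ∈ Icc P.L₁ P.L₂, HasDerivWithinAt u (p x) (Icc P.L₁ P.L₂) x)
    (hp : ∀ x ∈ Icc P.L₁ P.L₂, HasDerivWithinAt p (p' x) (Icc P.L₁ P.L₂) x)
    (ht : ∀ x ∈ Icc P.L₁ P.L₂, HasDerivWithinAt t (q x) (Icc P.L₁ P.L₂) x)
    (hq : ∀ x ∈ Icc P.L₁ P.L₂, HasDerivWithinAt q (q' x) (Icc P.L₁ P.L₂) x)
    (h₁ : ∀ x ∈ Icc P.L₁ P.L₂, (P.a : ℂ) * p' x = P.m * q x - (s : ℂ) ^ 2 * u x)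
    (h₂ : ∀ x ∈ Icc P.L₁ P.L₂,
      (P.k : ℂ) ^ 2 * q' x = Complex.I * s * t x + P.m * (Complex.I * s * p x))
    (hvl : ∀ x ∈ Icc 0 P.L₁, HasDerivWithinAt v (w x) (Icc 0 P.L₁) x)
    (hwl : ∀ x ∈ Icc 0 P.L₁, HasDerivWithinAt w (w' x) (Icc 0 P.L₁) x)
    (hvr : ∀ x ∈ Icc P.L₂ P.L₃, HasDerivWithinAt v (w x) (Icc P.L₂ P.L₃) x)
    (hwr : ∀ x ∈ Icc P.L₂ P.L₃, HasDerivWithinAt w (w' x) (Icc P.L₂ P.L₃) x)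
    (h₃ : ∀ x ∈ Icc 0 P.L₁ ∪ Icc P.L₂ P.L₃, (P.b : ℂ) * w' x = -(s : ℂ) ^ 2 * v x)
    (hv0 : v 0 = 0) (hv3 : v P.L₃ = 0) (hc1 : u P.L₁ = v P.L₁) (hc2 : u P.L₂ = v P.L₂)
    (hf1 : P.a * p P.L₁ - P.m * t P.L₁ = P.b * w P.L₁)
    (hf2 : P.a * p P.L₂ - P.m * t P.L₂ = P.b * w P.L₂)
    (hq1 : q P.L₁ = 0) (hq2 : q P.L₂ = 0) :
    (∀ x ∈ Icc P.L₁ P.L₂, u x = 0 ∧ p x = 0 ∧ t x = 0 ∧ q x = 0) ∧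
      ∀ x ∈ Icc 0 P.L₁ ∪ Icc P.L₂ P.L₃, v x = 0 ∧ w x = 0 := by
  have m0 : (0 : ℝ) ∈ Icc 0 P.L₁ := ⟨le_rfl, P.hL₁.le⟩
  have m1 : P.L₁ ∈ Icc 0 P.L₁ := ⟨P.hL₁.le, le_rfl⟩
  have m2 : P.L₂ ∈ Icc P.L₂ P.L₃ := ⟨le_rfl, P.hL₃.le⟩
  have m3 : P.L₃ ∈ Icc P.L₂ P.L₃ := ⟨P.hL₃.le, le_rfl⟩
  have n1 : P.L₁ ∈ Icc P.L₁ P.L₂ := ⟨le_rfl, P.hL₂.le⟩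
  have n2 : P.L₂ ∈ Icc P.L₁ P.L₂ := ⟨P.hL₂.le, le_rfl⟩
  have hl := fun x hx => h₃ x (Or.inl hx)
  have hr := fun x hx => h₃ x (Or.inr hx)
  -- The flux at each interface equals the flux at the clamped end, where `v = 0`.
  have f1 := elastic_flux_eq hvl hwl hl m1 m0
  have f2 := elastic_flux_eq hvr hwr hr m2 m3
  rw [hv0, mul_zero, star_zero, mul_zero, Complex.zero_re] at f1
  rw [hv3, mul_zero, star_zero, mul_zero, Complex.zero_re] at f2
  have hz := thermoelastic_eq_zero P.hm.ne' P.hk.ne' hs P.hL₂ hu hp ht hq h₁ h₂ hq1 hq2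
    (by rw [hf1, hc1, f1]) (by rw [hf2, hc2, f2])
  have hb : (P.b : ℂ) ≠ 0 := by exact_mod_cast P.hb.ne'
  obtain ⟨a1, a2, a3, -⟩ := hz _ n1
  obtain ⟨b1, b2, b3, -⟩ := hz _ n2
  -- With the middle part at rest, balance of forces forces `w = 0` at the interface, and continuity
  -- gives `v = 0` there.
  rw [a2, a3, mul_zero, mul_zero, sub_zero, eq_comm, mul_eq_zero, or_iff_right hb] at hf1
  rw [b2, b3, mul_zero, mul_zero, sub_zero, eq_comm, mul_eq_zero, or_iff_right hb] at hf2
  refine ⟨hz, ?_⟩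
  rintro x (hx | hx)
  · exact elastic_eq_zero P.hb hs hvl hwl hl m1 (hc1 ▸ a1) hf1 x hx
  · exact elastic_eq_zero P.hb hs hvr hwr hr m2 (hc2 ▸ b1) hf2 x hx

/-! ## The inhomogeneous boundary value problem -/

lemma IsPrimitiveOn.congr_right {c g h : ℝ → ℂ} {α β : ℝ} (hc : IsPrimitiveOn c g α β)
    (hab : α ≤ β) (hgh : ∀ x ∈ Icc α β, h x = g x) : IsPrimitiveOn c h α β := by
  refine hc.congr_ae hab ?_
  filter_upwards [ae_restrict_mem measurableSet_Ioo] with x hx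
  exact (hgh x (Ioo_subset_Icc_self hx)).symm

/-! ### The shooting map from initial values to boundary defects -/

namespace Bar

variable (P : Bar)

/-- The first order system for `(u, u_x, θ, θ_x)` in the thermoelastic part at frequency `s`. -/
noncomputable def midSystem (s : ℝ) : (ℂ × ℂ × ℂ × ℂ) →L[ℝ] (ℂ × ℂ × ℂ × ℂ) :=
  LinearMap.toContinuousLinearMap
    { toFun := fun y => (y.2.1, (P.a : ℂ)⁻¹ * (P.m * y.2.2.2 - (s : ℂ) ^ 2 * y.1), y.2.2.2,
        ((P.k : ℂ) ^ 2)⁻¹ * (Complex.I * s * y.2.2.1 + P.m * (Complex.I * s * y.2.1)))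
      map_add' := fun x y => by
        ext1; · rfl
        ext1; · simp only [Prod.fst_add, Prod.snd_add]; ring
        ext1; · rfl
        simp only [Prod.fst_add, Prod.snd_add]; ring
      map_smul' := fun c x => by
        ext1; · rfl
        ext1; · simp only [Prod.smul_fst, Prod.smul_snd, Complex.real_smul, RingHom.id_apply]; ring
        ext1; · rfl
        simp only [Prod.smul_fst, Prod.smul_snd, Complex.real_smul, RingHom.id_apply]; ring }

/-- The first order system for `(v, v_x)` in the elastic parts at frequency `s`. -/
noncomputable def outSystem (s : ℝ) : (ℂ × ℂ) →L[ℝ] (ℂ × ℂ) :=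
  LinearMap.toContinuousLinearMap
    { toFun := fun y => (y.2, (P.b : ℂ)⁻¹ * (-(s : ℂ) ^ 2 * y.1))
      map_add' := fun x y => by
        ext1; · rfl
        simp only [Prod.fst_add, Prod.snd_add]; ring
      map_smul' := fun c x => by
        ext1; · rfl
        simp only [Prod.smul_fst, Prod.smul_snd, Complex.real_smul, RingHom.id_apply]; ring }

/-- The defect in the transmission conditions and in `θ_x = 0`, as a function of the values
`(u, u_x, θ, θ_x)` and `(v, v_x)` at `L₁` and at `L₂`. -/
noncomputable def boundaryDefect :
    ((ℂ × ℂ × ℂ × ℂ) × (ℂ × ℂ × ℂ × ℂ) × (ℂ × ℂ) × (ℂ × ℂ)) →L[ℝ] (ℂ × ℂ × ℂ × ℂ × ℂ × ℂ) :=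
  LinearMap.toContinuousLinearMap
    { toFun := fun y => (y.1.1 - y.2.2.1.1, y.2.1.1 - y.2.2.2.1,
        P.a * y.1.2.1 - P.m * y.1.2.2.1 - P.b * y.2.2.1.2,
        P.a * y.2.1.2.1 - P.m * y.2.1.2.2.1 - P.b * y.2.2.2.2, y.1.2.2.2, y.2.1.2.2.2)
      map_add' := fun x y => by
        ext1; · simp only [Prod.fst_add, Prod.snd_add]; ring
        ext1; · simp only [Prod.fst_add, Prod.snd_add]; ring
        ext1; · simp only [Prod.fst_add, Prod.snd_add]; ring
        ext1; · simp only [Prod.fst_add, Prod.snd_add]; ring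
        rfl
      map_smul' := fun c x => by
        simp only [Prod.smul_fst, Prod.smul_snd, Complex.real_smul, RingHom.id_apply, Prod.smul_mk,
          Prod.mk.injEq, and_true]
        refine ⟨?_, ?_, ?_, ?_⟩ <;> ring }

/-- The boundary defect of the solution of the homogeneous system with initial values `y` at
`L₁`, `(0, wl)` at `0` and `(0, wr)` at `L₃`. -/
noncomputable def homogeneousDefect (s : ℝ) :
    ((ℂ × ℂ × ℂ × ℂ) × ℂ × ℂ) →L[ℝ] (ℂ × ℂ × ℂ × ℂ × ℂ × ℂ) :=
  P.boundaryDefect.comp <|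
    (ContinuousLinearMap.fst ℝ _ _).prod <|
    ((propagator (P.midSystem s) (P.L₂ - P.L₁)).comp (ContinuousLinearMap.fst ℝ _ _)).prod <|
    (((propagator (P.outSystem s) (P.L₁ - 0)).comp (ContinuousLinearMap.inr ℝ ℂ ℂ)).comp
      ((ContinuousLinearMap.fst ℝ _ _).comp (ContinuousLinearMap.snd ℝ _ _))).prod
    (((propagator (P.outSystem s) (P.L₂ - P.L₃)).comp (ContinuousLinearMap.inr ℝ ℂ ℂ)).comp
      ((ContinuousLinearMap.snd ℝ _ _).comp (ContinuousLinearMap.snd ℝ _ _)))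

variable {P}

lemma homogeneousDefect_apply (s : ℝ) (y : ℂ × ℂ × ℂ × ℂ) (wl wr : ℂ) :
    P.homogeneousDefect s (y, wl, wr) = P.boundaryDefect (y,
      propagator (P.midSystem s) (P.L₂ - P.L₁) y, propagator (P.outSystem s) (P.L₁ - 0) (0, wl),
      propagator (P.outSystem s) (P.L₂ - P.L₃) (0, wr)) := rfl

lemma hasDerivAt_mid {s : ℝ} {y G : ℝ → ℂ × ℂ × ℂ × ℂ}
    (hy : ∀ x, HasDerivAt y (P.midSystem s (y x + G x)) x) (x : ℝ) :
    HasDerivAt (fun x => (y x).1) (y x + G x).2.1 x ∧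
    HasDerivAt (fun x => (y x).2.1)
      ((P.a : ℂ)⁻¹ * (P.m * (y x + G x).2.2.2 - (s : ℂ) ^ 2 * (y x + G x).1)) x ∧
    HasDerivAt (fun x => (y x).2.2.1) (y x + G x).2.2.2 x ∧
    HasDerivAt (fun x => (y x).2.2.2) (((P.k : ℂ) ^ 2)⁻¹ * (Complex.I * s * (y x + G x).2.2.1
      + P.m * (Complex.I * s * (y x + G x).2.1))) x := by
  have h1 : HasDerivAt (fun x => (y x).1) _ x := (hy x).fst
  have h2 : HasDerivAt (fun x => (y x).2) _ x := (hy x).snd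
  have h3 : HasDerivAt (fun x => (y x).2.1) _ x := h2.fst
  have h4 : HasDerivAt (fun x => (y x).2.2) _ x := h2.snd
  have h5 : HasDerivAt (fun x => (y x).2.2.1) _ x := h4.fst
  have h6 : HasDerivAt (fun x => (y x).2.2.2) _ x := h4.snd
  exact ⟨h1, h3, h5, h6⟩

lemma hasDerivAt_out {s : ℝ} {y G : ℝ → ℂ × ℂ}
    (hy : ∀ x, HasDerivAt y (P.outSystem s (y x + G x)) x) (x : ℝ) :
    HasDerivAt (fun x => (y x).1) (y x + G x).2 x ∧
    HasDerivAt (fun x => (y x).2) ((P.b : ℂ)⁻¹ * (-(s : ℂ) ^ 2 * (y x + G x).1)) x :=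
  ⟨(hy x).fst, (hy x).snd⟩

/-- Initial values with zero defect generate a solution of the homogeneous transmission problem. By
`transmission_eq_zero` that solution vanishes, and so do its initial values. -/
lemma homogeneousDefect_injective {s : ℝ} (hs : s ≠ 0) :
    Function.Injective (P.homogeneousDefect s) := by
  rw [injective_iff_map_eq_zero]
  rintro ⟨y, wl, wr⟩ h
  have ha : (P.a : ℂ) ≠ 0 := by exact_mod_cast P.ha.ne'
  have hb : (P.b : ℂ) ≠ 0 := by exact_mod_cast P.hb.ne'
  have hk : (P.k : ℂ) ≠ 0 := by exact_mod_cast P.hk.ne'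
  rw [homogeneousDefect_apply] at h
  simp only [Prod.ext_iff] at h
  obtain ⟨e1, e2, e3, e4, e5, e6⟩ := h
  set Y : ℝ → ℂ × ℂ × ℂ × ℂ := fun x => propagator (P.midSystem s) (x - P.L₁) y with hY
  set Vl : ℝ → ℂ × ℂ := fun x => propagator (P.outSystem s) (x - 0) (0, wl) with hVl
  set Vr : ℝ → ℂ × ℂ := fun x => propagator (P.outSystem s) (x - P.L₃) (0, wr) with hVr
  have hYd : ∀ x, HasDerivAt Y (P.midSystem s (Y x + 0)) x := fun x => by
    rw [add_zero]; exact hasDerivAt_propagator_apply _ _ _ _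
  have hVld : ∀ x, HasDerivAt Vl (P.outSystem s (Vl x + 0)) x := fun x => by
    rw [add_zero]; exact hasDerivAt_propagator_apply _ _ _ _
  have hVrd : ∀ x, HasDerivAt Vr (P.outSystem s (Vr x + 0)) x := fun x => by
    rw [add_zero]; exact hasDerivAt_propagator_apply _ _ _ _
  have hY1 : Y P.L₁ = y := by simp [hY, propagator_zero]
  have hVl0 : Vl 0 = (0, wl) := by simp [hVl, propagator_zero]
  have hVr3 : Vr P.L₃ = (0, wr) := by simp [hVr, propagator_zero]
  have dm := hasDerivAt_mid (G := 0) hYd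
  have dl := hasDerivAt_out (G := 0) hVld
  have dr := hasDerivAt_out (G := 0) hVrd
  simp only [Pi.zero_apply, add_zero] at dm dl dr
  have hlt : ¬ P.L₂ ≤ P.L₁ := not_le.2 P.hL₂
  have hgt : ∀ x ∈ Icc P.L₂ P.L₃, ¬ x ≤ P.L₁ := fun x hx => not_le.2 (P.hL₂.trans_le hx.1)
  -- The solutions on the two elastic intervals are glued by testing `x ≤ L₁`; on each closed
  -- interval only one branch is seen, so derivatives within the interval are unaffected.
  have hgl : ∀ {f f' g g' : ℝ → ℂ}, (∀ x, HasDerivAt f (f' x) x) → ∀ x ∈ Icc 0 P.L₁,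
      HasDerivWithinAt (fun x => if x ≤ P.L₁ then f x else g x)
        (if x ≤ P.L₁ then f' x else g' x) (Icc 0 P.L₁) x := by
    intro f f' g g' hf x hx
    rw [if_pos hx.2]
    exact (hf x).hasDerivWithinAt.congr (fun y hy => if_pos hy.2) (if_pos hx.2)
  have hgr : ∀ {f f' g g' : ℝ → ℂ}, (∀ x, HasDerivAt g (g' x) x) → ∀ x ∈ Icc P.L₂ P.L₃,
      HasDerivWithinAt (fun x => if x ≤ P.L₁ then f x else g x)
        (if x ≤ P.L₁ then f' x else g' x) (Icc P.L₂ P.L₃) x := by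
    intro f f' g g' hg x hx
    rw [if_neg (hgt x hx)]
    exact (hg x).hasDerivWithinAt.congr (fun y hy => if_neg (hgt y hy)) (if_neg (hgt x hx))
  have key := transmission_eq_zero P hs
    (v := fun x => if x ≤ P.L₁ then (Vl x).1 else (Vr x).1)
    (w := fun x => if x ≤ P.L₁ then (Vl x).2 else (Vr x).2)
    (w' := fun x => if x ≤ P.L₁ then (P.b : ℂ)⁻¹ * (-(s : ℂ) ^ 2 * (Vl x).1)
      else (P.b : ℂ)⁻¹ * (-(s : ℂ) ^ 2 * (Vr x).1))
    (fun x _ => (dm x).1.hasDerivWithinAt) (fun x _ => (dm x).2.1.hasDerivWithinAt)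
    (fun x _ => (dm x).2.2.1.hasDerivWithinAt) (fun x _ => (dm x).2.2.2.hasDerivWithinAt)
    (fun x _ => mul_inv_cancel_left₀ ha _)
    (fun x _ => mul_inv_cancel_left₀ (pow_ne_zero 2 hk) _)
    (hgl fun x => (dl x).1) (hgl fun x => (dl x).2) (hgr fun x => (dr x).1)
    (hgr fun x => (dr x).2)
    (fun x _ => by split_ifs <;> exact mul_inv_cancel_left₀ hb _)
    (by simp [P.hL₁.le, hVl0]) (by simp [P.hL₂.trans P.hL₃, hVr3])
    (by rw [if_pos le_rfl, hY1]; exact sub_eq_zero.1 e1)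
    (by rw [if_neg hlt]; exact sub_eq_zero.1 e2)
    (by rw [if_pos le_rfl, hY1]; exact sub_eq_zero.1 e3)
    (by rw [if_neg hlt]; exact sub_eq_zero.1 e4)
    (by rw [hY1]; exact e5) e6
  obtain ⟨k1, k2⟩ := key
  obtain ⟨r1, r2, r3, r4⟩ := k1 P.L₁ ⟨le_rfl, P.hL₂.le⟩
  have r5 := (k2 0 (Or.inl ⟨le_rfl, P.hL₁.le⟩)).2
  have r6 := (k2 P.L₃ (Or.inr ⟨P.hL₃.le, le_rfl⟩)).2
  rw [hY1] at r1 r2 r3 r4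
  simp only [P.hL₁.le, if_true, hVl0] at r5
  simp only [not_le.2 (P.hL₂.trans P.hL₃), if_false, hVr3] at r6
  simp only [Prod.ext_iff]
  exact ⟨⟨r1, r2, r3, r4⟩, r5, r6⟩

/-- Six complex initial values (four at `L₁`, one slope at each clamped end) face six complex
conditions (two continuity, two force balance, two insulation), so injectivity suffices. -/
lemma homogeneousDefect_surjective {s : ℝ} (hs : s ≠ 0) :
    Function.Surjective (P.homogeneousDefect s) := by
  have h := (LinearMap.injective_iff_surjective_of_finrank_eq_finrank
    (f := (P.homogeneousDefect s : ((ℂ × ℂ × ℂ × ℂ) × ℂ × ℂ) →ₗ[ℝ] (ℂ × ℂ × ℂ × ℂ × ℂ × ℂ)))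
    (by simp [Module.finrank_prod, Complex.finrank_real_complex])).1
    (homogeneousDefect_injective hs)
  exact h

lemma volume_mid_ne_top : volume P.mid ≠ ⊤ := measure_Ioo_lt_top.ne

lemma volume_out_ne_top : volume P.out ≠ ⊤ :=
  (measure_union_lt_top measure_Ioo_lt_top measure_Ioo_lt_top).ne

end Bar

/-! ### Bounded solvability of the resolvent system -/

namespace Bar

/-- `(u, p, t, q, v, w) = (u, u_x, θ, θ_x, v, v_x)` solves the resolvent system at frequency `s`
with the given right-hand sides in the equations for `u_xx`, `θ_xx` and `v_xx`. -/
structure IsHarmonicSolution (P : Bar) (s : ℝ) (g₂ g₄ h u p t q v w : ℝ → ℂ) : Prop where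
  hu : IsPrimitiveOn u p P.L₁ P.L₂
  hp : IsPrimitiveOn p (fun x => (P.a : ℂ)⁻¹ * (P.m * q x - (s : ℂ) ^ 2 * u x) + g₂ x) P.L₁ P.L₂
  ht : IsPrimitiveOn t q P.L₁ P.L₂
  hq : IsPrimitiveOn q (fun x => ((P.k : ℂ) ^ 2)⁻¹ * (Complex.I * s * t x
    + P.m * (Complex.I * s * p x)) + g₄ x) P.L₁ P.L₂
  hvl : IsPrimitiveOn v w 0 P.L₁
  hvr : IsPrimitiveOn v w P.L₂ P.L₃
  hwl : IsPrimitiveOn w (fun x => (P.b : ℂ)⁻¹ * (-(s : ℂ) ^ 2 * v x) + h x) 0 P.L₁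
  hwr : IsPrimitiveOn w (fun x => (P.b : ℂ)⁻¹ * (-(s : ℂ) ^ 2 * v x) + h x) P.L₂ P.L₃
  v_left : v 0 = 0
  v_right : v P.L₃ = 0
  match₁ : u P.L₁ = v P.L₁
  match₂ : u P.L₂ = v P.L₂
  force₁ : P.a * p P.L₁ - P.m * t P.L₁ = P.b * w P.L₁
  force₂ : P.a * p P.L₂ - P.m * t P.L₂ = P.b * w P.L₂
  insul₁ : q P.L₁ = 0
  insul₂ : q P.L₂ = 0

variable {P : Bar}

/-- The solution with forcing is `y + G`, not `y`. As `G` has entries only in the components of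
`u_x` and `θ_x`, those two are corrected, while `u` and `θ` are read off from `y` unchanged. -/
lemma isPrimitiveOn_mid {s α β : ℝ} {y : ℝ → ℂ × ℂ × ℂ × ℂ} {G₂ G₄ g₂ g₄ : ℝ → ℂ}
    (hy : ∀ x, HasDerivAt y (P.midSystem s (y x + (0, G₂ x, 0, G₄ x))) x) (h₂ : Continuous G₂)
    (h₄ : Continuous G₄) (hg₂ : IsPrimitiveOn G₂ g₂ α β) (hg₄ : IsPrimitiveOn G₄ g₄ α β) :
    IsPrimitiveOn (fun x => (y x).1) (fun x => (y x).2.1 + G₂ x) α β ∧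
    IsPrimitiveOn (fun x => (y x).2.1 + G₂ x) (fun x => (P.a : ℂ)⁻¹ *
      (P.m * ((y x).2.2.2 + G₄ x) - (s : ℂ) ^ 2 * (y x).1) + g₂ x) α β ∧
    IsPrimitiveOn (fun x => (y x).2.2.1) (fun x => (y x).2.2.2 + G₄ x) α β ∧
    IsPrimitiveOn (fun x => (y x).2.2.2 + G₄ x) (fun x => ((P.k : ℂ) ^ 2)⁻¹ *
      (Complex.I * s * (y x).2.2.1 + P.m * (Complex.I * s * ((y x).2.1 + G₂ x))) + g₄ x) α β := by
  have d := hasDerivAt_mid (G := fun x => (0, G₂ x, 0, G₄ x)) hy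
  simp only [Prod.fst_add, Prod.snd_add, add_zero] at d
  have hc : Continuous y := continuous_iff_continuousAt.2 fun x => (hy x).continuousAt
  exact ⟨.of_hasDerivAt (fun x => (d x).1) (by fun_prop),
    (IsPrimitiveOn.of_hasDerivAt (fun x => (d x).2.1) (by fun_prop)).add hg₂,
    .of_hasDerivAt (fun x => (d x).2.2.1) (by fun_prop),
    (IsPrimitiveOn.of_hasDerivAt (fun x => (d x).2.2.2) (by fun_prop)).add hg₄⟩

lemma isPrimitiveOn_out {s α β : ℝ} {y : ℝ → ℂ × ℂ} {H h : ℝ → ℂ}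
    (hy : ∀ x, HasDerivAt y (P.outSystem s (y x + (0, H x))) x) (hH : Continuous H)
    (hh : IsPrimitiveOn H h α β) :
    IsPrimitiveOn (fun x => (y x).1) (fun x => (y x).2 + H x) α β ∧
    IsPrimitiveOn (fun x => (y x).2 + H x)
      (fun x => (P.b : ℂ)⁻¹ * (-(s : ℂ) ^ 2 * (y x).1) + h x) α β := by
  have d := hasDerivAt_out (G := fun x => (0, H x)) hy
  simp only [Prod.fst_add, Prod.snd_add, add_zero] at d
  have hc : Continuous y := continuous_iff_continuousAt.2 fun x => (hy x).continuousAt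
  exact ⟨.of_hasDerivAt (fun x => (d x).1) (by fun_prop),
    (IsPrimitiveOn.of_hasDerivAt (fun x => (d x).2) (by fun_prop)).add hh⟩

/-- The general solution of `z' = M (z + G)` with `z(x₀) = y`. -/
lemma _root_.Transmission.hasDerivAt_add_propagator {E : Type*} [NormedAddCommGroup E]
    [NormedSpace ℝ E] [CompleteSpace E] {M : E →L[ℝ] E} {z G : ℝ → E}
    (hz : ∀ x, HasDerivAt z (M (z x + G x)) x) (x₀ : ℝ) (y : E) (x : ℝ) :
    HasDerivAt (fun x => z x + propagator M (x - x₀) y)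
      (M (z x + propagator M (x - x₀) y + G x)) x := by
  refine ((hz x).add (hasDerivAt_propagator_apply M x₀ y x)).congr_deriv ?_
  rw [← map_add]
  congr 1
  abel

/-- The resolvent system at a frequency `s ≠ 0` has a solution that is bounded by the right-hand
sides. -/
lemma exists_isHarmonicSolution (P : Bar) {s : ℝ} (hs : s ≠ 0) :
    ∃ C : ℝ, 0 ≤ C ∧ ∀ (g₂ g₄ : L2 P.mid) (h : L2 P.out) (B : ℝ), ‖g₂‖ ≤ B → ‖g₄‖ ≤ B →
      ‖h‖ ≤ B → ∃ u p t q v w : ℝ → ℂ, P.IsHarmonicSolution s g₂ g₄ h u p t q v w ∧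
        (∀ x ∈ Icc P.L₁ P.L₂, ‖u x‖ ≤ C * B ∧ ‖p x‖ ≤ C * B ∧ ‖t x‖ ≤ C * B) ∧
        ∀ x ∈ Icc 0 P.L₁ ∪ Icc P.L₂ P.L₃, ‖v x‖ ≤ C * B ∧ ‖w x‖ ≤ C * B := by
  have l1 := P.hL₁
  have l2 := P.hL₂
  have l3 := P.hL₃
  obtain ⟨Cm, hCm0, hCm⟩ := exists_bounded_solution (P.midSystem s) P.L₁ P.L₃
  obtain ⟨Cl, hCl0, hCl⟩ := exists_bounded_solution (P.outSystem s) 0 P.L₃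
  obtain ⟨Cr, hCr0, hCr⟩ := exists_bounded_solution (P.outSystem s) P.L₃ P.L₃
  obtain ⟨Km, hKm0, hKm⟩ := exists_bound_propagator (P.midSystem s) P.L₃
  obtain ⟨Ko, hKo0, hKo⟩ := exists_bound_propagator (P.outSystem s) P.L₃
  -- Surjectivity is used in quantitative form: every defect has a preimage of comparable norm.
  obtain ⟨Ch, hCh0, hCh⟩ := (P.homogeneousDefect s).exists_preimage_norm_le
    (homogeneousDefect_surjective hs)
  -- `N` bounds the primitives of the forcings, `K` the particular solutions (the summand `1`
  -- accounts for adding `G` back), and `C` also includes the homogeneous correction.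
  set N : ℝ := √(volume.real P.mid) + √(volume.real P.out) with hN
  have hN0 : 0 ≤ N := by positivity
  set K : ℝ := (Cm + Cl + Cr + 1) * N with hK
  have hK0 : 0 ≤ K := by positivity
  set C : ℝ := K + (Km + Ko) * (Ch * (‖P.boundaryDefect‖ * K)) with hC
  refine ⟨C, by positivity, fun g₂ g₄ h B hg₂ hg₄ hh => ?_⟩
  have hB0 : 0 ≤ B := (norm_nonneg _).trans hg₂
  have mm := P.isOpen_mid.measurableSet
  have mo := P.isOpen_out.measurableSet
  set G₂ := g₂.primitive P.L₁
  set G₄ := g₄.primitive P.L₁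
  set H := h.primitive 0
  have cG₂ : Continuous G₂ := g₂.continuous_primitive volume_mid_ne_top mm _
  have cG₄ : Continuous G₄ := g₄.continuous_primitive volume_mid_ne_top mm _
  have cH : Continuous H := h.continuous_primitive volume_out_ne_top mo _
  have bG₂ : ∀ x, ‖G₂ x‖ ≤ N * B := fun x =>
    (g₂.norm_primitive_le volume_mid_ne_top mm _ _).trans (by gcongr; simp [hN])
  have bG₄ : ∀ x, ‖G₄ x‖ ≤ N * B := fun x =>
    (g₄.norm_primitive_le volume_mid_ne_top mm _ _).trans (by gcongr; simp [hN])
  have bH : ∀ x, ‖H x‖ ≤ N * B := fun x =>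
    (h.norm_primitive_le volume_out_ne_top mo _ _).trans (by gcongr; simp [hN])
  have hNB : 0 ≤ N * B := by positivity
  have bG : ∀ x, ‖((0, G₂ x, 0, G₄ x) : ℂ × ℂ × ℂ × ℂ)‖ ≤ N * B := fun x => by
    simp only [norm_prod_le_iff, norm_zero]
    exact ⟨hNB, bG₂ x, hNB, bG₄ x⟩
  have bH' : ∀ x, ‖((0, H x) : ℂ × ℂ)‖ ≤ N * B := fun x => by
    simp only [norm_prod_le_iff, norm_zero]
    exact ⟨hNB, bH x⟩
  obtain ⟨zm, zm0, zmd, zmb⟩ := hCm (fun x => (0, G₂ x, 0, G₄ x)) (N * B) (by fun_prop) bG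
  obtain ⟨zl, zl0, zld, zlb⟩ := hCl (fun x => (0, H x)) (N * B) (by fun_prop) bH'
  obtain ⟨zr, zr0, zrd, zrb⟩ := hCr (fun x => (0, H x)) (N * B) (by fun_prop) bH'
  have am : ∀ x ∈ Icc P.L₁ P.L₂, |x - P.L₁| ≤ P.L₃ := fun x hx =>
    abs_le.2 ⟨by linarith [hx.1, hx.2], by linarith [hx.1, hx.2]⟩
  have al : ∀ x ∈ Icc 0 P.L₁, |x - 0| ≤ P.L₃ := fun x hx =>
    abs_le.2 ⟨by linarith [hx.1, hx.2], by linarith [hx.1, hx.2]⟩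
  have ar : ∀ x ∈ Icc P.L₂ P.L₃, |x - P.L₃| ≤ P.L₃ := fun x hx =>
    abs_le.2 ⟨by linarith [hx.1, hx.2], by linarith [hx.1, hx.2]⟩
  have hCK : ∀ c, c = Cm ∨ c = Cl ∨ c = Cr → c * (N * B) + N * B ≤ K * B := by
    intro c hc
    have : c ≤ Cm + Cl + Cr := by rcases hc with rfl | rfl | rfl <;> linarith
    have := mul_le_mul_of_nonneg_right this hNB
    rw [hK]
    linarith
  have bm : ∀ x ∈ Icc P.L₁ P.L₂, ‖zm x + (0, G₂ x, 0, G₄ x)‖ ≤ K * B := fun x hx =>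
    (norm_add_le_of_le (zmb x (am x hx)) (bG x)).trans (hCK _ (by simp))
  have bl : ∀ x ∈ Icc 0 P.L₁, ‖zl x + (0, H x)‖ ≤ K * B := fun x hx =>
    (norm_add_le_of_le (zlb x (al x hx)) (bH' x)).trans (hCK _ (by simp))
  have br : ∀ x ∈ Icc P.L₂ P.L₃, ‖zr x + (0, H x)‖ ≤ K * B := fun x hx =>
    (norm_add_le_of_le (zrb x (ar x hx)) (bH' x)).trans (hCK _ (by simp))
  have m0 : (0 : ℝ) ∈ Icc 0 P.L₁ := ⟨le_rfl, P.hL₁.le⟩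
  have m1 : P.L₁ ∈ Icc 0 P.L₁ := ⟨P.hL₁.le, le_rfl⟩
  have m2 : P.L₂ ∈ Icc P.L₂ P.L₃ := ⟨le_rfl, P.hL₃.le⟩
  have n1 : P.L₁ ∈ Icc P.L₁ P.L₂ := ⟨le_rfl, P.hL₂.le⟩
  have n2 : P.L₂ ∈ Icc P.L₁ P.L₂ := ⟨P.hL₂.le, le_rfl⟩
  set D := P.boundaryDefect (zm P.L₁ + (0, G₂ P.L₁, 0, G₄ P.L₁),
    zm P.L₂ + (0, G₂ P.L₂, 0, G₄ P.L₂), zl P.L₁ + (0, H P.L₁), zr P.L₂ + (0, H P.L₂)) with hD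
  have bD : ‖D‖ ≤ ‖P.boundaryDefect‖ * (K * B) := by
    refine (ContinuousLinearMap.le_opNorm _ _).trans ?_
    gcongr
    exact norm_prod_le_iff.2 ⟨bm _ n1, norm_prod_le_iff.2 ⟨bm _ n2, norm_prod_le_iff.2
      ⟨bl _ m1, br _ m2⟩⟩⟩
  -- `D` is the defect of the particular solutions, and these initial values produce a homogeneous
  -- solution whose defect cancels it. The clamped ends are untouched, since the correction starts
  -- there with displacement `0`.
  obtain ⟨⟨y, wl, wr⟩, hy, hyb⟩ := hCh (-D)
  rw [norm_neg] at hyb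
  have hyb' : ‖(y, wl, wr)‖ ≤ Ch * (‖P.boundaryDefect‖ * (K * B)) := hyb.trans (by gcongr)
  have by1 : ‖y‖ ≤ Ch * (‖P.boundaryDefect‖ * (K * B)) := (norm_fst_le _).trans hyb'
  have by2 : ‖((0, wl) : ℂ × ℂ)‖ ≤ Ch * (‖P.boundaryDefect‖ * (K * B)) := by
    rw [norm_prod_le_iff, norm_zero]
    exact ⟨by positivity, (norm_fst_le (wl, wr)).trans ((norm_snd_le (y, wl, wr)).trans hyb')⟩
  have by3 : ‖((0, wr) : ℂ × ℂ)‖ ≤ Ch * (‖P.boundaryDefect‖ * (K * B)) := by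
    rw [norm_prod_le_iff, norm_zero]
    exact ⟨by positivity, (norm_snd_le (wl, wr)).trans ((norm_snd_le (y, wl, wr)).trans hyb')⟩
  set Y : ℝ → ℂ × ℂ × ℂ × ℂ := fun x => zm x + propagator (P.midSystem s) (x - P.L₁) y with hY
  set Vl : ℝ → ℂ × ℂ := fun x => zl x + propagator (P.outSystem s) (x - 0) (0, wl) with hVl
  set Vr : ℝ → ℂ × ℂ := fun x => zr x + propagator (P.outSystem s) (x - P.L₃) (0, wr) with hVr
  have hY1 : Y P.L₁ = y := by simp [hY, propagator_zero, zm0]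
  have hVl0 : Vl 0 = (0, wl) := by simp [hVl, propagator_zero, zl0]
  have hVr3 : Vr P.L₃ = (0, wr) := by simp [hVr, propagator_zero, zr0]
  have bY : ∀ x ∈ Icc P.L₁ P.L₂, ‖Y x + (0, G₂ x, 0, G₄ x)‖ ≤ C * B := fun x hx => by
    calc _ = ‖(zm x + (0, G₂ x, 0, G₄ x)) + propagator (P.midSystem s) (x - P.L₁) y‖ := by
          congr 1; simp only [hY]; abel
      _ ≤ K * B + (Km + Ko) * (Ch * (‖P.boundaryDefect‖ * (K * B))) := by
          refine norm_add_le_of_le (bm x hx) ((ContinuousLinearMap.le_opNorm _ _).trans ?_)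
          gcongr
          exact (hKm _ (am x hx)).trans (by linarith)
      _ = C * B := by rw [hC]; ring
  have bVl : ∀ x ∈ Icc 0 P.L₁, ‖Vl x + (0, H x)‖ ≤ C * B := fun x hx => by
    calc _ = ‖(zl x + (0, H x)) + propagator (P.outSystem s) (x - 0) (0, wl)‖ := by
          congr 1; simp only [hVl]; abel
      _ ≤ K * B + (Km + Ko) * (Ch * (‖P.boundaryDefect‖ * (K * B))) := by
          refine norm_add_le_of_le (bl x hx) ((ContinuousLinearMap.le_opNorm _ _).trans ?_)
          gcongr
          exact (hKo _ (al x hx)).trans (by linarith)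
      _ = C * B := by rw [hC]; ring
  have bVr : ∀ x ∈ Icc P.L₂ P.L₃, ‖Vr x + (0, H x)‖ ≤ C * B := fun x hx => by
    calc _ = ‖(zr x + (0, H x)) + propagator (P.outSystem s) (x - P.L₃) (0, wr)‖ := by
          congr 1; simp only [hVr]; abel
      _ ≤ K * B + (Km + Ko) * (Ch * (‖P.boundaryDefect‖ * (K * B))) := by
          refine norm_add_le_of_le (br x hx) ((ContinuousLinearMap.le_opNorm _ _).trans ?_)
          gcongr
          exact (hKo _ (ar x hx)).trans (by linarith)
      _ = C * B := by rw [hC]; ring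
  obtain ⟨pm1, pm2, pm3, pm4⟩ := isPrimitiveOn_mid (hasDerivAt_add_propagator zmd P.L₁ y) cG₂ cG₄
    (g₂.isPrimitiveOn_primitive volume_mid_ne_top mm P.L₁ l2.le subset_rfl)
    (g₄.isPrimitiveOn_primitive volume_mid_ne_top mm P.L₁ l2.le subset_rfl)
  obtain ⟨pl1, pl2⟩ := isPrimitiveOn_out (hasDerivAt_add_propagator zld 0 (0, wl)) cH
    (h.isPrimitiveOn_primitive volume_out_ne_top mo 0 l1.le subset_union_left)
  obtain ⟨pr1, pr2⟩ := isPrimitiveOn_out (hasDerivAt_add_propagator zrd P.L₃ (0, wr)) cH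
    (h.isPrimitiveOn_primitive volume_out_ne_top mo 0 l3.le subset_union_right)
  have hbd : P.boundaryDefect (Y P.L₁ + (0, G₂ P.L₁, 0, G₄ P.L₁),
      Y P.L₂ + (0, G₂ P.L₂, 0, G₄ P.L₂), Vl P.L₁ + (0, H P.L₁), Vr P.L₂ + (0, H P.L₂)) = 0 := by
    have e : (Y P.L₁ + (0, G₂ P.L₁, 0, G₄ P.L₁), Y P.L₂ + (0, G₂ P.L₂, 0, G₄ P.L₂),
        Vl P.L₁ + (0, H P.L₁), Vr P.L₂ + (0, H P.L₂))
        = (zm P.L₁ + (0, G₂ P.L₁, 0, G₄ P.L₁), zm P.L₂ + (0, G₂ P.L₂, 0, G₄ P.L₂),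
          zl P.L₁ + (0, H P.L₁), zr P.L₂ + (0, H P.L₂))
          + (y, propagator (P.midSystem s) (P.L₂ - P.L₁) y,
            propagator (P.outSystem s) (P.L₁ - 0) (0, wl),
            propagator (P.outSystem s) (P.L₂ - P.L₃) (0, wr)) := by
      refine Prod.ext ?_ (Prod.ext ?_ (Prod.ext ?_ ?_))
      · change Y P.L₁ + _ = zm P.L₁ + _ + y
        rw [hY1, zm0, zero_add, add_comm]
      all_goals exact add_right_comm _ _ _
    rw [e, map_add, ← homogeneousDefect_apply, hy, ← hD, add_neg_cancel]
  simp only [Prod.ext_iff] at hbd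
  obtain ⟨e1, e2, e3, e4, e5, e6⟩ := hbd
  have hlt : ¬ P.L₂ ≤ P.L₁ := not_le.2 P.hL₂
  have hlt3 : ¬ P.L₃ ≤ P.L₁ := not_le.2 (P.hL₂.trans P.hL₃)
  have hle : ∀ x ∈ Icc 0 P.L₁, x ≤ P.L₁ := fun x hx => hx.2
  have hgt : ∀ x ∈ Icc P.L₂ P.L₃, ¬ x ≤ P.L₁ := fun x hx => not_le.2 (P.hL₂.trans_le hx.1)
  refine ⟨fun x => (Y x).1, fun x => (Y x).2.1 + G₂ x, fun x => (Y x).2.2.1,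
    fun x => (Y x).2.2.2 + G₄ x, fun x => if x ≤ P.L₁ then (Vl x).1 else (Vr x).1,
    fun x => if x ≤ P.L₁ then (Vl x).2 + H x else (Vr x).2 + H x, ?_, ?_, ?_⟩
  · constructor
    · exact pm1
    · exact pm2
    · exact pm3
    · exact pm4
    · exact (pl1.congr_left fun x hx => if_pos (hle x hx)).congr_right l1.le
        fun x hx => if_pos (hle x hx)
    · exact (pr1.congr_left fun x hx => if_neg (hgt x hx)).congr_right l3.le
        fun x hx => if_neg (hgt x hx)
    · exact (pl2.congr_left fun x hx => if_pos (hle x hx)).congr_right l1.le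
        fun x hx => by simp only [if_pos (hle x hx)]; rfl
    · exact (pr2.congr_left fun x hx => if_neg (hgt x hx)).congr_right l3.le
        fun x hx => by simp only [if_neg (hgt x hx)]; rfl
    · simp only [if_pos l1.le, hVl0]
    · simp only [if_neg hlt3, hVr3]
    · simp only [le_refl, if_true]
      have : (Y P.L₁ + (0, G₂ P.L₁, 0, G₄ P.L₁)).1 - (Vl P.L₁ + (0, H P.L₁)).1 = 0 := e1
      simpa [sub_eq_zero] using this
    · simp only [if_neg hlt]
      have : (Y P.L₂ + (0, G₂ P.L₂, 0, G₄ P.L₂)).1 - (Vr P.L₂ + (0, H P.L₂)).1 = 0 := e2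
      simpa [sub_eq_zero] using this
    · simp only [le_refl, if_true]
      have : (P.a : ℂ) * (Y P.L₁ + (0, G₂ P.L₁, 0, G₄ P.L₁)).2.1
        - P.m * (Y P.L₁ + (0, G₂ P.L₁, 0, G₄ P.L₁)).2.2.1
        - P.b * (Vl P.L₁ + (0, H P.L₁)).2 = 0 := e3
      simpa only [sub_eq_zero, Prod.fst_add, Prod.snd_add, add_zero] using this
    · simp only [if_neg hlt]
      have : (P.a : ℂ) * (Y P.L₂ + (0, G₂ P.L₂, 0, G₄ P.L₂)).2.1
        - P.m * (Y P.L₂ + (0, G₂ P.L₂, 0, G₄ P.L₂)).2.2.1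
        - P.b * (Vr P.L₂ + (0, H P.L₂)).2 = 0 := e4
      simpa only [sub_eq_zero, Prod.fst_add, Prod.snd_add, add_zero] using this
    · exact e5
    · exact e6
  · intro x hx
    have h1 := bY x hx
    simp only [norm_prod_le_iff, Prod.fst_add, Prod.snd_add, add_zero] at h1
    exact ⟨h1.1, h1.2.1, h1.2.2.1⟩
  · rintro x (hx | hx)
    · have h1 := bVl x hx
      simp only [norm_prod_le_iff, Prod.fst_add, Prod.snd_add, add_zero] at h1
      simpa only [if_pos (hle x hx)] using h1
    · have h1 := bVr x hx
      simp only [norm_prod_le_iff, Prod.fst_add, Prod.snd_add, add_zero] at h1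
      simpa only [if_neg (hgt x hx)] using h1

end Bar

/-! ## The energy norm -/

namespace Bar

variable (P : Bar)

lemma closure_mid : closure P.mid = Icc P.L₁ P.L₂ := closure_Ioo P.hL₂.ne

lemma closure_out : closure P.out = Icc 0 P.L₁ ∪ Icc P.L₂ P.L₃ := by
  rw [out, closure_union, closure_Ioo P.hL₁.ne, closure_Ioo P.hL₃.ne]

lemma isBounded_mid : Bornology.IsBounded P.mid := Metric.isBounded_Ioo _ _

lemma isBounded_out : Bornology.IsBounded P.out :=
  (Metric.isBounded_Ioo _ _).union (Metric.isBounded_Ioo _ _)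

variable {P}

lemma hasWeakDeriv_mid {f g : L2 P.mid} {c : ℝ → ℂ} (hf : (f : ℝ → ℂ) =ᵐ[volume.restrict P.mid] c)
    (hc : IsPrimitiveOn c g P.L₁ P.L₂) : HasWeakDeriv f g :=
  hasWeakDeriv_of_isPrimitiveOn P.hL₂ hf hc

lemma hasWeakDeriv_out {f g : L2 P.out} {c : ℝ → ℂ} (hf : (f : ℝ → ℂ) =ᵐ[volume.restrict P.out] c)
    (hl : IsPrimitiveOn c g 0 P.L₁) (hr : IsPrimitiveOn c g P.L₂ P.L₃) : HasWeakDeriv f g :=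
  hasWeakDeriv_of_isPrimitiveOn_union P.hL₁ P.hL₂.le P.hL₃ hf hl hr

end Bar

namespace HF

variable {P : Bar}

lemma norm_sq (U : HF P) : ‖U‖ ^ 2 = P.a * ‖wderiv U.u1‖ ^ 2 + ‖U.u2‖ ^ 2 + ‖U.θ‖ ^ 2
    + P.b * ‖wderiv U.v1‖ ^ 2 + ‖U.v2‖ ^ 2 := by
  rw [← re_energyInner_self, ← inner_self_eq_norm_sq (𝕜 := ℂ) U]
  rfl

lemma norm_le_of_forall_le (U : HF P) {K : ℝ} (hK : 0 ≤ K) (h1 : ‖wderiv U.u1‖ ≤ K)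
    (h2 : ‖U.u2‖ ≤ K) (h3 : ‖U.θ‖ ≤ K) (h4 : ‖wderiv U.v1‖ ≤ K) (h5 : ‖U.v2‖ ≤ K) :
    ‖U‖ ≤ √(P.a + P.b + 3) * K := by
  have ha := P.ha
  have hb := P.hb
  refine (pow_le_pow_iff_left₀ (norm_nonneg _) (by positivity) two_ne_zero).1 ?_
  rw [mul_pow, Real.sq_sqrt (by positivity), norm_sq]
  calc _ ≤ P.a * K ^ 2 + K ^ 2 + K ^ 2 + P.b * K ^ 2 + K ^ 2 := by gcongr
    _ = _ := by ring

/-- The displacements are controlled by their derivatives. -/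
lemma norm_displacement_le (P : Bar) : ∃ C : ℝ, 0 ≤ C ∧ ∀ U : HF P,
    ‖U.u1‖ ≤ C * (‖wderiv U.u1‖ + ‖wderiv U.v1‖) ∧
    ‖U.v1‖ ≤ C * (‖wderiv U.u1‖ + ‖wderiv U.v1‖) := by
  set Nm := √(volume.real P.mid) with hNm
  set No := √(volume.real P.out) with hNo
  have hNm0 : 0 ≤ Nm := Real.sqrt_nonneg _
  have hNo0 : 0 ≤ No := Real.sqrt_nonneg _
  -- One factor passes from the `L²` norm of the derivative to a sup bound, the other from the sup
  -- bound to the `L²` norm.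
  refine ⟨(Nm + No) * (Nm + No), by positivity, fun U => ?_⟩
  obtain ⟨c, d, hc, hd, h0, h3, h1, -⟩ := U.compatible
  have wu := hasWeakDeriv_wderiv U.u1_mem
  have wv := hasWeakDeriv_wderiv U.v1_mem
  have m0 : (0 : ℝ) ∈ Icc 0 P.L₁ := ⟨le_rfl, P.hL₁.le⟩
  have m1 : P.L₁ ∈ Icc 0 P.L₁ := ⟨P.hL₁.le, le_rfl⟩
  have m3 : P.L₃ ∈ Icc P.L₂ P.L₃ := ⟨P.hL₃.le, le_rfl⟩
  have n1 : P.L₁ ∈ Icc P.L₁ P.L₂ := ⟨le_rfl, P.hL₂.le⟩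
  -- A Poincaré inequality: the elastic displacements are integrated from the clamped ends, and the
  -- middle one from its value at `L₁`, which the left elastic part supplies.
  have bl : ∀ x ∈ Icc 0 P.L₁, ‖d x‖ ≤ No * ‖wderiv U.v1‖ := by
    intro x hx
    have e := (hd.isPrimitiveOn wv P.hL₁ subset_union_left).2 0 m0 x hx
    rw [h0, sub_zero] at e
    rw [e]
    exact L2.norm_integral_le Bar.volume_out_ne_top _ (α := 0) (β := P.L₁) subset_union_left m0 hx
  have br : ∀ x ∈ Icc P.L₂ P.L₃, ‖d x‖ ≤ No * ‖wderiv U.v1‖ := by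
    intro x hx
    have e := (hd.isPrimitiveOn wv P.hL₃ subset_union_right).2 P.L₃ m3 x hx
    rw [h3, sub_zero] at e
    rw [e]
    exact L2.norm_integral_le Bar.volume_out_ne_top _ (α := P.L₂) (β := P.L₃) subset_union_right
      m3 hx
  have bm : ∀ x ∈ Icc P.L₁ P.L₂, ‖c x‖ ≤ No * ‖wderiv U.v1‖ + Nm * ‖wderiv U.u1‖ := by
    intro x hx
    have e := (hc.isPrimitiveOn wu P.hL₂ subset_rfl).2 P.L₁ n1 x hx
    rw [sub_eq_iff_eq_add', h1] at e
    rw [e]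
    exact norm_add_le_of_le (bl _ m1) (L2.norm_integral_le Bar.volume_mid_ne_top _ (α := P.L₁)
      (β := P.L₂) subset_rfl n1 hx)
  have pu := norm_nonneg (wderiv U.u1)
  have pv := norm_nonneg (wderiv U.v1)
  have hsum : No * ‖wderiv U.v1‖ + Nm * ‖wderiv U.u1‖
      ≤ (Nm + No) * (‖wderiv U.u1‖ + ‖wderiv U.v1‖) := by
    nlinarith [mul_nonneg hNm0 pv, mul_nonneg hNo0 pu]
  constructor
  · refine (hc.norm_le Bar.volume_mid_ne_top P.isOpen_mid.measurableSet (by positivity)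
      fun x hx => bm x (Ioo_subset_Icc_self hx)).trans ?_
    rw [mul_assoc]
    gcongr
    linarith
  · refine (hd.norm_le Bar.volume_out_ne_top P.isOpen_out.measurableSet
      (K := No * ‖wderiv U.v1‖ + Nm * ‖wderiv U.u1‖) (by positivity) ?_).trans ?_
    · have : 0 ≤ Nm * ‖wderiv U.u1‖ := by positivity
      rintro x (hx | hx)
      · exact (bl x (Ioo_subset_Icc_self hx)).trans (by linarith)
      · exact (br x (Ioo_subset_Icc_self hx)).trans (by linarith)
    · rw [mul_assoc]
      gcongr
      linarith

/-- All components of a state are controlled by its energy. -/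
lemma norm_components_le (P : Bar) : ∃ C : ℝ, 0 ≤ C ∧ ∀ U : HF P,
    ‖U.u1‖ ≤ C * ‖U‖ ∧ ‖U.v1‖ ≤ C * ‖U‖ ∧ ‖wderiv U.u1‖ ≤ C * ‖U‖ ∧ ‖wderiv U.v1‖ ≤ C * ‖U‖ ∧
    ‖U.θ‖ ≤ C * ‖U‖ ∧ ‖U.u2‖ ≤ C * ‖U‖ ∧ ‖U.v2‖ ≤ C * ‖U‖ := by
  obtain ⟨K, hK, hKU⟩ := norm_displacement_le P
  have ha := P.ha
  have hb := P.hb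
  -- `S` removes the weights `a` and `b` from the energy; the final factor `2 * K + 1` covers the
  -- displacements, which need both derivatives, and the components that occur in the energy
  -- directly.
  set S := 1 + (√P.a)⁻¹ + (√P.b)⁻¹ with hS
  have hsa : 0 < √P.a := Real.sqrt_pos.2 ha
  have hsb : 0 < √P.b := Real.sqrt_pos.2 hb
  have hS1 : 1 ≤ S := by
    have := inv_pos.2 hsa; have := inv_pos.2 hsb; linarith
  refine ⟨(2 * K + 1) * S, by positivity, fun U => ?_⟩
  have hU := norm_sq U
  have p1 : 0 ≤ P.a * ‖wderiv U.u1‖ ^ 2 := by positivity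
  have p2 : 0 ≤ ‖U.u2‖ ^ 2 := by positivity
  have p3 : 0 ≤ ‖U.θ‖ ^ 2 := by positivity
  have p4 : 0 ≤ P.b * ‖wderiv U.v1‖ ^ 2 := by positivity
  have p5 : 0 ≤ ‖U.v2‖ ^ 2 := by positivity
  have hn := norm_nonneg U
  have sq_le : ∀ {x : ℝ}, 0 ≤ x → x ^ 2 ≤ ‖U‖ ^ 2 → x ≤ ‖U‖ := fun hx h =>
    (pow_le_pow_iff_left₀ hx hn two_ne_zero).1 h
  have c1 : √P.a * ‖wderiv U.u1‖ ≤ ‖U‖ :=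
    sq_le (by positivity) (by rw [mul_pow, Real.sq_sqrt ha.le]; linarith)
  have c2 : √P.b * ‖wderiv U.v1‖ ≤ ‖U‖ :=
    sq_le (by positivity) (by rw [mul_pow, Real.sq_sqrt hb.le]; linarith)
  have d1 : ‖wderiv U.u1‖ ≤ S * ‖U‖ := by
    refine ((le_inv_mul_iff₀ hsa).2 c1).trans ?_
    gcongr
    have := inv_pos.2 hsb; linarith
  have d2 : ‖wderiv U.v1‖ ≤ S * ‖U‖ := by
    refine ((le_inv_mul_iff₀ hsb).2 c2).trans ?_
    gcongr
    have := inv_pos.2 hsa; linarith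
  have hone : ‖U‖ ≤ S * ‖U‖ := le_mul_of_one_le_left hn hS1
  have hup : S * ‖U‖ ≤ (2 * K + 1) * S * ‖U‖ := by
    gcongr
    nlinarith
  have hdisp : K * (‖wderiv U.u1‖ + ‖wderiv U.v1‖) ≤ (2 * K + 1) * S * ‖U‖ := by
    calc _ ≤ K * (S * ‖U‖ + S * ‖U‖) := by gcongr
      _ ≤ K * (S * ‖U‖ + S * ‖U‖) + S * ‖U‖ := by
        have : 0 ≤ S * ‖U‖ := by positivity
        linarith
      _ = _ := by ring
  refine ⟨(hKU U).1.trans hdisp, (hKU U).2.trans hdisp, d1.trans hup, d2.trans hup, ?_, ?_, ?_⟩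
  · exact ((sq_le (norm_nonneg _) (by linarith)).trans hone).trans hup
  · exact ((sq_le (norm_nonneg _) (by linarith)).trans hone).trans hup
  · exact ((sq_le (norm_nonneg _) (by linarith)).trans hone).trans hup

end HF

/-! ## The resolvent on the imaginary axis -/

/-- The state built from a solution of the resolvent system solves the resolvent equation. -/
lemma Bar.IsHarmonicSolution.exists_state {P : Bar} {s : ℝ} {F : HF P} {u p t q v w : ℝ → ℂ}
    (H : P.IsHarmonicSolution s
      ((-(P.a : ℂ)⁻¹) • ((Complex.I * s) • F.u1 + F.u2) : L2 P.mid)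
      ((-((P.k : ℂ) ^ 2)⁻¹) • (F.θ + (P.m : ℂ) • wderiv F.u1) : L2 P.mid)
      ((-(P.b : ℂ)⁻¹) • ((Complex.I * s) • F.v1 + F.v2) : L2 P.out) u p t q v w) :
    ∃ (U : HF P) (h : U ∈ domAF P), (Complex.I * s) • U - applyAF P U h = F ∧
      IsContRep U.u1 u ∧ IsContRep (wderiv U.u1) p ∧ IsContRep U.θ t ∧ IsContRep U.v1 v ∧
      IsContRep (wderiv U.v1) w ∧ U.u2 = (Complex.I * s) • U.u1 - F.u1 ∧
      U.v2 = (Complex.I * s) • U.v1 - F.v1 := by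
  have ha : (P.a : ℂ) ≠ 0 := by exact_mod_cast P.ha.ne'
  have hb : (P.b : ℂ) ≠ 0 := by exact_mod_cast P.hb.ne'
  have hk : (P.k : ℂ) ^ 2 ≠ 0 := pow_ne_zero 2 (by exact_mod_cast P.hk.ne')
  set z : ℂ := Complex.I * s with hz
  have hz2 : z ^ 2 = -(s : ℂ) ^ 2 := by rw [hz, mul_pow, Complex.I_sq]; ring
  have exm : ∀ {c g : ℝ → ℂ}, IsPrimitiveOn c g P.L₁ P.L₂ → ∃ f : L2 P.mid, IsContRep f c :=
    fun h => exists_isContRep P.isBounded_mid (by rw [P.closure_mid]; exact h.continuousOn)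
  have exo : ∀ {c g g' : ℝ → ℂ}, IsPrimitiveOn c g 0 P.L₁ → IsPrimitiveOn c g' P.L₂ P.L₃ →
      ∃ f : L2 P.out, IsContRep f c := fun h h' => exists_isContRep P.isBounded_out (by
    rw [P.closure_out]
    exact h.continuousOn.union_of_isClosed h'.continuousOn isClosed_Icc isClosed_Icc)
  obtain ⟨uL, hu⟩ := exm H.hu
  obtain ⟨pL, hp⟩ := exm H.hp
  obtain ⟨tL, ht⟩ := exm H.ht
  obtain ⟨qL, hq⟩ := exm H.hq
  obtain ⟨vL, hv⟩ := exo H.hvl H.hvr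
  obtain ⟨wL, hw⟩ := exo H.hwl H.hwr
  have hol : ∀ {f g : ℝ → ℂ}, f =ᵐ[volume.restrict P.out] g →
      f =ᵐ[volume.restrict (Ioo 0 P.L₁)] g := fun h =>
    ae_mono (Measure.restrict_mono subset_union_left le_rfl) h
  have hor : ∀ {f g : ℝ → ℂ}, f =ᵐ[volume.restrict P.out] g →
      f =ᵐ[volume.restrict (Ioo P.L₂ P.L₃)] g := fun h =>
    ae_mono (Measure.restrict_mono subset_union_right le_rfl) h
  -- The velocities are eliminated by `u² = z u¹ - F.u1` and `v² = z v¹ - F.v1`. Substituting them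
  -- into the other three equations and solving for `u_xx`, `θ_xx` and `v_xx` leaves exactly these
  -- forcing terms.
  set g₂ : L2 P.mid := (-(P.a : ℂ)⁻¹) • (z • F.u1 + F.u2) with hg₂
  set g₄ : L2 P.mid := (-((P.k : ℂ) ^ 2)⁻¹) • (F.θ + (P.m : ℂ) • wderiv F.u1) with hg₄
  set h₂ : L2 P.out := (-(P.b : ℂ)⁻¹) • (z • F.v1 + F.v2) with hh₂
  have du : HasWeakDeriv uL pL :=
    Bar.hasWeakDeriv_mid hu.2 (H.hu.congr_ae P.hL₂.le hp.2.symm)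
  have dt : HasWeakDeriv tL qL :=
    Bar.hasWeakDeriv_mid ht.2 (H.ht.congr_ae P.hL₂.le hq.2.symm)
  have dv : HasWeakDeriv vL wL :=
    Bar.hasWeakDeriv_out hv.2
      (H.hvl.congr_ae P.hL₁.le (hol hw.2.symm)) (H.hvr.congr_ae P.hL₃.le (hor hw.2.symm))
  have dp : HasWeakDeriv pL
      ((P.a : ℂ)⁻¹ • ((P.m : ℂ) • qL + (-(s : ℂ) ^ 2) • uL) + g₂) := by
    refine Bar.hasWeakDeriv_mid hp.2 (H.hp.congr_ae P.hL₂.le ?_)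
    filter_upwards [(((hq.smul (P.m : ℂ)).add (hu.smul (-(s : ℂ) ^ 2))).smul (P.a : ℂ)⁻¹).2,
      Lp.coeFn_add ((P.a : ℂ)⁻¹ • ((P.m : ℂ) • qL + (-(s : ℂ) ^ 2) • uL)) g₂] with x e1 e2
    rw [e2, Pi.add_apply, e1]
    simp only [Pi.smul_apply, Pi.add_apply, smul_eq_mul]
    ring
  have dq : HasWeakDeriv qL
      (((P.k : ℂ) ^ 2)⁻¹ • (z • tL + (P.m : ℂ) • (z • pL)) + g₄) := by
    refine Bar.hasWeakDeriv_mid hq.2 (H.hq.congr_ae P.hL₂.le ?_)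
    filter_upwards [(((ht.smul z).add ((hp.smul z).smul (P.m : ℂ))).smul ((P.k : ℂ) ^ 2)⁻¹).2,
      Lp.coeFn_add (((P.k : ℂ) ^ 2)⁻¹ • (z • tL + (P.m : ℂ) • (z • pL))) g₄] with x e1 e2
    rw [e2, Pi.add_apply, e1]
    simp only [Pi.smul_apply, Pi.add_apply, smul_eq_mul]
    rw [hz]
  have ew : (fun x => (P.b : ℂ)⁻¹ * (-(s : ℂ) ^ 2 * v x) + h₂ x) =ᵐ[volume.restrict P.out]
      ((P.b : ℂ)⁻¹ • ((-(s : ℂ) ^ 2) • vL) + h₂ : L2 P.out) := by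
    filter_upwards [((hv.smul (-(s : ℂ) ^ 2)).smul (P.b : ℂ)⁻¹).2,
      Lp.coeFn_add ((P.b : ℂ)⁻¹ • ((-(s : ℂ) ^ 2) • vL)) h₂] with x e1 e2
    rw [e2, Pi.add_apply, e1]
    simp only [Pi.smul_apply, smul_eq_mul]
  have dw : HasWeakDeriv wL ((P.b : ℂ)⁻¹ • ((-(s : ℂ) ^ 2) • vL) + h₂) :=
    Bar.hasWeakDeriv_out hw.2
      (H.hwl.congr_ae P.hL₁.le (hol ew)) (H.hwr.congr_ae P.hL₃.le (hor ew))
  have om := P.isOpen_mid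
  have oo := P.isOpen_out
  have eu := du.wderiv_eq om
  have et := dt.wderiv_eq om
  have ev := dv.wderiv_eq oo
  have ep := dp.wderiv_eq om
  have eq := dq.wderiv_eq om
  have ew' := dw.wderiv_eq oo
  have mu : uL ∈ H1 P.mid := ⟨_, du⟩
  have mv : vL ∈ H1 P.out := ⟨_, dv⟩
  have hcomp : P.Compatible uL vL :=
    ⟨u, v, hu, hv, H.v_left, H.v_right, H.match₁, H.match₂⟩
  have neg1 : ∀ {Ω : Set ℝ} (f g : L2 Ω), f - g = f + (-1 : ℂ) • g := fun f g => by
    rw [neg_one_smul, sub_eq_add_neg]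
  have du2 : HasWeakDeriv (z • uL - F.u1) (z • pL - wderiv F.u1) := by
    rw [neg1, neg1]
    exact (du.smul z).add ((hasWeakDeriv_wderiv F.u1_mem).smul (-1))
  have hcomp2 : P.Compatible (z • uL - F.u1) (z • vL - F.v1) := by
    rw [neg1, neg1]
    exact (hcomp.smul z).add (F.compatible.smul (-1))
  have mv2 : z • vL - F.v1 ∈ H1 P.out :=
    sub_mem (Submodule.smul_mem _ z mv) F.v1_mem
  have hneg : ∀ {Ω : Set ℝ} {c : ℂ} {f : L2 Ω}, c ≠ 0 → c • ((-c⁻¹) • f) = -f := fun hc => by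
    rw [neg_smul, smul_neg, smul_inv_smul₀ hc]
  set U : HF P := HF.mk uL vL tL (z • uL - F.u1) (z • vL - F.v1) mu mv hcomp with hU
  have hdom : U ∈ domAF P := by
    refine ⟨⟨mu, ?_⟩, ⟨mv, ?_⟩, ⟨⟨_, dt⟩, ?_⟩, ⟨_, du2⟩, mv2, hcomp2, ⟨p, t, w, ?_, ht, ?_,
      H.force₁, H.force₂⟩, ⟨q, ?_, H.insul₁, H.insul₂⟩⟩
    · rw [hU, HF.u1_mk, eu]; exact ⟨_, dp⟩
    · rw [hU, HF.v1_mk, ev]; exact ⟨_, dw⟩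
    · rw [hU, HF.θ_mk, et]; exact ⟨_, dq⟩
    · rw [hU, HF.u1_mk, eu]; exact hp
    · rw [hU, HF.v1_mk, ev]; exact hw
    · rw [hU, HF.θ_mk, et]; exact hq
  refine ⟨U, hdom, ?_, hu, by rw [hU, HF.u1_mk, eu]; exact hp, ht, hv,
    by rw [hU, HF.v1_mk, ev]; exact hw, rfl, rfl⟩
  rw [sub_eq_iff_eq_add]
  refine HF.ext ?_ ?_ ?_ ?_ ?_
  · simp only [applyAF, HF.u1_smul, HF.u1_add, HF.u1_mk, hU, HF.u2_mk]
    abel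
  · simp only [applyAF, HF.v1_smul, HF.v1_add, HF.v1_mk, hU, HF.v2_mk]
    abel
  · simp only [applyAF, HF.θ_smul, HF.θ_add, HF.θ_mk, hU, HF.u2_mk]
    rw [et, eq, du2.wderiv_eq om, smul_add, smul_inv_smul₀ hk, hg₄, hneg hk]
    module
  · simp only [applyAF, HF.u2_smul, HF.u2_add, HF.u2_mk, hU, HF.u1_mk, HF.θ_mk]
    rw [et, eu, ep, smul_add, smul_inv_smul₀ ha, hg₂, hneg ha, ← hz2]
    module
  · simp only [applyAF, HF.v2_smul, HF.v2_add, HF.v2_mk, hU, HF.v1_mk]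
    rw [ev, ew', smul_add, smul_inv_smul₀ hb, hh₂, hneg hb, ← hz2]
    module

/-- The components of `F` are bounded by its energy norm, hence so are the forcing terms of the
reduced system. The sup bounds on its solution control each `L²` norm in the energy of `U`. -/
lemma exists_resolvent_solution (P : Bar) {s : ℝ} (hs : s ≠ 0) :
    ∃ C : ℝ, ∀ F : HF P, ∃ (U : HF P) (h : U ∈ domAF P),
      (Complex.I * s) • U - applyAF P U h = F ∧ ‖U‖ ≤ C * ‖F‖ := by
  obtain ⟨C₁, hC₁, hF⟩ := HF.norm_components_le P
  obtain ⟨C₂, hC₂, hS⟩ := P.exists_isHarmonicSolution hs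
  have ha := P.ha
  have hb := P.hb
  have hk := P.hk
  have hm := P.hm
  set K : ℝ := (P.a⁻¹ + P.b⁻¹ + (P.k ^ 2)⁻¹) * (|s| + 1 + P.m) with hK
  set N : ℝ := 1 + √(volume.real P.mid) + √(volume.real P.out) with hN
  have hN1 : 1 ≤ N := by
    have := Real.sqrt_nonneg (volume.real P.mid)
    have := Real.sqrt_nonneg (volume.real P.out)
    linarith
  set M : ℝ := (|s| + 1) * (N * (C₂ * (K * C₁))) + C₁ with hM
  have hK0 : 0 ≤ K := by positivity
  have hM0 : 0 ≤ M := by positivity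
  refine ⟨√(P.a + P.b + 3) * M, fun F => ?_⟩
  obtain ⟨b1, b2, b3, b4, b5, b6, b7⟩ := hF F
  have hz : ‖Complex.I * (s : ℂ)‖ = |s| := by simp
  set B := K * (C₁ * ‖F‖) with hB
  have hF0 := norm_nonneg F
  have hB0 : 0 ≤ B := by positivity
  -- One estimate for all three forcing terms, with `(r, z)` equal to `(a, is)`, `(k², m)` and `(b,
  -- is)`; the two factors of `K` dominate `r⁻¹` and `‖z‖ + 1` in each case.
  have hcoef : ∀ {X : Type} [NormedAddCommGroup X] [NormedSpace ℂ X] (r : ℝ) (z : ℂ) (f g : X),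
      0 < r → r⁻¹ ≤ P.a⁻¹ + P.b⁻¹ + (P.k ^ 2)⁻¹ → ‖z‖ + 1 ≤ |s| + 1 + P.m → ‖f‖ ≤ C₁ * ‖F‖ →
      ‖g‖ ≤ C₁ * ‖F‖ → ‖(-(r : ℂ)⁻¹) • (z • f + g)‖ ≤ B := by
    intro X _ _ r z f g hr hr' hz hf hg
    rw [norm_smul, norm_neg, norm_inv, Complex.norm_real, Real.norm_of_nonneg hr.le, hB, hK,
      mul_assoc]
    gcongr
    calc ‖z • f + g‖ ≤ ‖z‖ * (C₁ * ‖F‖) + C₁ * ‖F‖ :=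
          norm_add_le_of_le (by rw [norm_smul]; gcongr) hg
      _ = (‖z‖ + 1) * (C₁ * ‖F‖) := by ring
      _ ≤ _ := by gcongr
  have pa := inv_pos.2 ha
  have pb := inv_pos.2 hb
  have pk := inv_pos.2 (pow_pos hk 2)
  have e1 : ‖(-(P.a : ℂ)⁻¹) • ((Complex.I * s) • F.u1 + F.u2)‖ ≤ B :=
    hcoef P.a _ _ _ ha (by linarith) (by rw [hz]; linarith) b1 b6
  have e2 : ‖(-((P.k : ℂ) ^ 2)⁻¹) • (F.θ + (P.m : ℂ) • wderiv F.u1)‖ ≤ B := by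
    rw [add_comm, ← Complex.ofReal_pow]
    refine hcoef (P.k ^ 2) _ _ _ (by positivity) (by linarith) ?_ b3 b5
    rw [Complex.norm_real, Real.norm_of_nonneg hm.le]
    linarith [abs_nonneg s]
  have e3 : ‖(-(P.b : ℂ)⁻¹) • ((Complex.I * s) • F.v1 + F.v2)‖ ≤ B :=
    hcoef P.b _ _ _ hb (by linarith) (by rw [hz]; linarith) b2 b7
  obtain ⟨u, p, t, q, v, w, H, bm, bo⟩ := hS _ _ _ B e1 e2 e3
  obtain ⟨U, h, hU, hu, hp, ht, hv, hw, hu2, hv2⟩ := H.exists_state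
  refine ⟨U, h, hU, ?_⟩
  have hCB : 0 ≤ C₂ * B := by positivity
  have nm : ∀ {f : L2 P.mid} {c : ℝ → ℂ}, IsContRep f c →
      (∀ x ∈ Icc P.L₁ P.L₂, ‖c x‖ ≤ C₂ * B) → ‖f‖ ≤ N * (C₂ * B) := fun hf hc =>
    (hf.norm_le Bar.volume_mid_ne_top P.isOpen_mid.measurableSet hCB
      fun x hx => hc x (Ioo_subset_Icc_self hx)).trans (by
        gcongr; have := Real.sqrt_nonneg (volume.real P.out); linarith)
  have no : ∀ {f : L2 P.out} {c : ℝ → ℂ}, IsContRep f c →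
      (∀ x ∈ Icc 0 P.L₁ ∪ Icc P.L₂ P.L₃, ‖c x‖ ≤ C₂ * B) → ‖f‖ ≤ N * (C₂ * B) := fun hf hc =>
    (hf.norm_le Bar.volume_out_ne_top P.isOpen_out.measurableSet hCB
      fun x hx => hc x (union_subset_union Ioo_subset_Icc_self Ioo_subset_Icc_self hx)).trans (by
        gcongr; have := Real.sqrt_nonneg (volume.real P.mid); linarith)
  have hMF : (|s| + 1) * (N * (C₂ * B)) + C₁ * ‖F‖ = M * ‖F‖ := by rw [hM, hB]; ring
  have hNB : 0 ≤ N * (C₂ * B) := by positivity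
  have hsB : 0 ≤ |s| * (N * (C₂ * B)) := by positivity
  have hCF : 0 ≤ C₁ * ‖F‖ := by positivity
  have hbase : N * (C₂ * B) ≤ M * ‖F‖ := by rw [← hMF]; linarith
  have hvel : ∀ {X : Type} [NormedAddCommGroup X] [NormedSpace ℂ X] (f g : X),
      ‖f‖ ≤ N * (C₂ * B) → ‖g‖ ≤ C₁ * ‖F‖ → ‖(Complex.I * (s : ℂ)) • f - g‖ ≤ M * ‖F‖ := by
    intro X _ _ f g hf hg
    calc _ ≤ |s| * (N * (C₂ * B)) + C₁ * ‖F‖ :=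
          (norm_sub_le _ _).trans (by rw [norm_smul, hz]; gcongr)
      _ ≤ _ := by rw [← hMF]; linarith
  rw [mul_assoc]
  refine U.norm_le_of_forall_le (by positivity) ((nm hp fun x hx => (bm x hx).2.1).trans hbase) ?_
    ((nm ht fun x hx => (bm x hx).2.2).trans hbase) ((no hw fun x hx => (bo x hx).2).trans hbase) ?_
  · rw [hu2]
    exact hvel _ _ (nm hu fun x hx => (bm x hx).1) b1
  · rw [hv2]
    exact hvel _ _ (no hv fun x hx => (bo x hx).1) b2

/-! ## Continuous representatives -/

/-- A continuous weak derivative is a classical one, one-sided at the endpoints. This makes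
eigenfunctions accessible to the pointwise energy argument. -/
lemma IsContRep.hasDerivWithinAt {Ω : Set ℝ} {f g : L2 Ω} {c d : ℝ → ℂ} (hf : IsContRep f c)
    (hg : IsContRep g d) (h : HasWeakDeriv f g) {α β : ℝ} (hab : α < β) (hs : Ioo α β ⊆ Ω) :
    ∀ x ∈ Icc α β, HasDerivWithinAt c (d x) (Icc α β) x := by
  intro x hx
  have hcl : Icc α β ⊆ closure Ω := by
    rw [← closure_Ioo hab.ne]
    exact closure_mono hs
  exact ((hf.isPrimitiveOn h hab hs).congr_ae hab.le
    (ae_mono (Measure.restrict_mono hs le_rfl) hg.2)).hasDerivWithinAt (hg.1.mono hcl) hab hx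

lemma IsContRep.eq_of_eqOn {Ω : Set ℝ} (hΩ : MeasurableSet Ω) {f g : L2 Ω} {c d : ℝ → ℂ}
    (hf : IsContRep f c) (hg : IsContRep g d) (h : ∀ x ∈ Ω, c x = d x) : f = g := by
  refine Lp.ext ?_
  filter_upwards [hf.2, hg.2, ae_restrict_mem hΩ] with x h1 h2 hx
  rw [h1, h2, h x hx]

/-- A function whose weak derivative is constant on an interval is affine there. -/
lemma IsContRep.sub_eq_mul {Ω : Set ℝ} {f g : L2 Ω} {c d : ℝ → ℂ} (hf : IsContRep f c)
    (hg : IsContRep g d) (h : HasWeakDeriv f g) {α β : ℝ} (hab : α < β) (hs : Ioo α β ⊆ Ω) {r : ℂ}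
    (hr : ∀ x ∈ Icc α β, d x = r) {x y : ℝ} (hx : x ∈ Icc α β) (hy : y ∈ Icc α β) :
    c y - c x = (y - x) * r := by
  have hp := ((hf.isPrimitiveOn h hab hs).congr_ae hab.le
    (ae_mono (Measure.restrict_mono hs le_rfl) hg.2)).congr_right (h := fun _ => r) hab.le
    fun x hx => (hr x hx).symm
  rw [hp.2 x hx y hy, intervalIntegral.integral_const, Complex.real_smul, Complex.ofReal_sub]

/-! ## Resolvent set and kernel -/

section Unbounded

variable {E : Type*} [NormedAddCommGroup E] [NormedSpace ℂ E]

/-- Uniqueness makes any choice of solutions linear in the right-hand side, and the estimate makes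
it bounded. -/
lemma mem_resolventSetOf {A : E →ₗ.[ℂ] E} {z : ℂ} {C : ℝ}
    (hsurj : ∀ y : E, ∃ x : A.domain, z • (x : E) - A x = y ∧ ‖(x : E)‖ ≤ C * ‖y‖)
    (hinj : ∀ x : A.domain, z • (x : E) - A x = 0 → x = 0) : z ∈ resolventSetOf A := by
  choose r hr hrb using hsurj
  have huniq : ∀ x x' : A.domain, z • (x : E) - A x = z • (x' : E) - A x' → x = x' := by
    intro x x' h
    refine sub_eq_zero.1 (hinj _ ?_)
    rw [Submodule.coe_sub, A.map_sub, smul_sub, sub_sub_sub_comm, h, sub_self]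
  let R : E →ₗ[ℂ] E :=
    { toFun := fun y => r y
      map_add' := fun y y' => by
        rw [← Submodule.coe_add]
        congr 1
        refine huniq _ _ ?_
        rw [hr, Submodule.coe_add, A.map_add, smul_add, add_sub_add_comm, hr, hr]
      map_smul' := fun c y => by
        rw [RingHom.id_apply, ← Submodule.coe_smul]
        congr 1
        refine huniq _ _ ?_
        rw [hr, Submodule.coe_smul, A.map_smul, smul_comm, ← smul_sub, hr] }
  refine ⟨R.mkContinuous C hrb, fun y => ⟨(r y).2, hr y⟩, fun x => ?_⟩
  have : r (z • (x : E) - A x) = x := huniq _ _ (hr _)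
  exact congrArg Subtype.val this

lemma mem_kerOf {A : E →ₗ.[ℂ] E} {x : E} : x ∈ kerOf A ↔ ∃ h : x ∈ A.domain, A ⟨x, h⟩ = 0 := by
  simp only [kerOf, Submodule.mem_map, LinearMap.mem_ker, Submodule.subtype_apply]
  constructor
  · rintro ⟨y, hy, rfl⟩
    exact ⟨y.2, hy⟩
  · rintro ⟨h, hx⟩
    exact ⟨⟨x, h⟩, hx, rfl⟩

lemma stationarySolutions_eq_kerOf (A : E →ₗ.[ℂ] E) : stationarySolutions A = kerOf A := by
  ext W
  rw [SetLike.mem_coe, mem_kerOf]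
  constructor
  · intro h
    obtain ⟨hd, hW⟩ := h.equation 0 le_rfl
    -- The one-sided derivative at time `0` is unique and a constant has derivative `0`, so `A W =
    -- 0`.
    exact ⟨hd, (uniqueDiffOn_Ici (0 : ℝ) 0 self_mem_Ici).eq_deriv _ hW
      (hasDerivWithinAt_const _ _ _)⟩
  · rintro ⟨hd, hW⟩
    exact ⟨rfl, contDiffOn_const, fun t _ => ⟨hd, by
      rw [hW]; exact hasDerivWithinAt_const _ _ _⟩⟩

/-- A bounded inverse of `-A` would send `A x = 0` back to `x`. -/
lemma zero_mem_spectrumOf {A : E →ₗ.[ℂ] E} {x : E} (hx : x ∈ kerOf A) (h0 : x ≠ 0) :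
    (0 : ℂ) ∈ spectrumOf A := by
  rintro ⟨R, -, hR⟩
  obtain ⟨hd, hA⟩ := mem_kerOf.1 hx
  have := hR ⟨x, hd⟩
  rw [hA, zero_smul, sub_zero, map_zero] at this
  exact h0 this.symm

end Unbounded

/-! ### Nonzero imaginary frequencies -/

variable {P : Bar}

/-- The eigenvalue equation expresses the second weak derivatives through functions that already
have continuous representatives. The eigenfunction is therefore a classical solution on the closed
intervals, and `transmission_eq_zero` applies. -/
lemma eq_zero_of_applyAF_eq_smul {s : ℝ} (hs : s ≠ 0) {U : HF P} (hU : U ∈ domAF P)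
    (h : applyAF P U hU = (Complex.I * s) • U) : U = 0 := by
  set z : ℂ := Complex.I * s with hz
  have hz2 : z ^ 2 = -(s : ℂ) ^ 2 := by rw [hz, mul_pow, Complex.I_sq]; ring
  have ha : (P.a : ℂ) ≠ 0 := by exact_mod_cast P.ha.ne'
  have hb : (P.b : ℂ) ≠ 0 := by exact_mod_cast P.hb.ne'
  have hk : (P.k : ℂ) ^ 2 ≠ 0 := pow_ne_zero 2 (by exact_mod_cast P.hk.ne')
  have E1 : U.u2 = z • U.u1 := congrArg HF.u1 h
  have E2 : U.v2 = z • U.v1 := congrArg HF.v1 h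
  have E3 : (P.k : ℂ) ^ 2 • wderiv (wderiv U.θ) - (P.m : ℂ) • wderiv U.u2 = z • U.θ :=
    congrArg HF.θ h
  have E4 : (P.a : ℂ) • wderiv (wderiv U.u1) - (P.m : ℂ) • wderiv U.θ = z • U.u2 :=
    congrArg HF.u2 h
  have E5 : (P.b : ℂ) • wderiv (wderiv U.v1) = z • U.v2 := congrArg HF.v2 h
  obtain ⟨⟨mu, mu'⟩, ⟨mv, mv'⟩, ⟨mt, mt'⟩, -, -, -, ⟨p, t, w, hp, ht, hw, hf1, hf2⟩,
    ⟨q, hq, hq1, hq2⟩⟩ := hU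
  obtain ⟨u, v, hu, hv, hv0, hv3, hc1, hc2⟩ := U.compatible
  rw [E1, wderiv_smul P.isOpen_mid z mu, sub_eq_iff_eq_add, ← eq_inv_smul_iff₀ hk] at E3
  rw [E1, sub_eq_iff_eq_add, ← eq_inv_smul_iff₀ ha] at E4
  rw [E2, ← eq_inv_smul_iff₀ hb] at E5
  -- A continuous representative of `u_xx`, built from those of `u` and `θ_x`; the next ones serve
  -- `θ_xx` and `v_xx` in the same way.
  have hp' := ((((hu.smul z).smul z).add (hq.smul (P.m : ℂ))).smul (P.a : ℂ)⁻¹)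
  rw [← E4] at hp'
  have hq' := (((ht.smul z).add ((hp.smul z).smul (P.m : ℂ))).smul ((P.k : ℂ) ^ 2)⁻¹)
  rw [← E3] at hq'
  have hw' := (((hv.smul z).smul z).smul (P.b : ℂ)⁻¹)
  rw [← E5] at hw'
  have du := hasWeakDeriv_wderiv mu
  have dp := hasWeakDeriv_wderiv mu'
  have dt := hasWeakDeriv_wderiv mt
  have dq := hasWeakDeriv_wderiv mt'
  have dv := hasWeakDeriv_wderiv mv
  have dw := hasWeakDeriv_wderiv mv'
  obtain ⟨k1, k2⟩ := transmission_eq_zero P hs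
    (hu.hasDerivWithinAt hp du P.hL₂ subset_rfl) (hp.hasDerivWithinAt hp' dp P.hL₂ subset_rfl)
    (ht.hasDerivWithinAt hq dt P.hL₂ subset_rfl) (hq.hasDerivWithinAt hq' dq P.hL₂ subset_rfl)
    (fun x _ => by
      simp only [Pi.smul_apply, Pi.add_apply, smul_eq_mul]
      rw [mul_inv_cancel_left₀ ha]
      linear_combination u x * hz2)
    (fun x _ => by
      simp only [Pi.smul_apply, Pi.add_apply, smul_eq_mul]
      rw [mul_inv_cancel_left₀ hk])
    (hv.hasDerivWithinAt hw dv P.hL₁ subset_union_left)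
    (hw.hasDerivWithinAt hw' dw P.hL₁ subset_union_left)
    (hv.hasDerivWithinAt hw dv P.hL₃ subset_union_right)
    (hw.hasDerivWithinAt hw' dw P.hL₃ subset_union_right)
    (fun x _ => by
      simp only [Pi.smul_apply, smul_eq_mul]
      rw [mul_inv_cancel_left₀ hb]
      linear_combination v x * hz2)
    hv0 hv3 hc1 hc2 hf1 hf2 hq1 hq2
  have zu : U.u1 = 0 := hu.eq_of_eqOn P.isOpen_mid.measurableSet IsContRep.zero
    fun x hx => (k1 x (Ioo_subset_Icc_self hx)).1
  have zt : U.θ = 0 := ht.eq_of_eqOn P.isOpen_mid.measurableSet IsContRep.zero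
    fun x hx => (k1 x (Ioo_subset_Icc_self hx)).2.2.1
  have zv : U.v1 = 0 := hv.eq_of_eqOn P.isOpen_out.measurableSet IsContRep.zero
    fun x hx => (k2 x (union_subset_union Ioo_subset_Icc_self Ioo_subset_Icc_self hx)).1
  exact HF.ext zu zv zt (by rw [E1, zu, smul_zero]; rfl) (by rw [E2, zv, smul_zero]; rfl)

lemma I_mul_mem_resolventSetOf (P : Bar) {s : ℝ} (hs : s ≠ 0) :
    Complex.I * s ∈ resolventSetOf (AF P) := by
  obtain ⟨C, hC⟩ := exists_resolvent_solution P hs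
  refine mem_resolventSetOf (C := C) (fun F => ?_) fun U hU => ?_
  · obtain ⟨U, h, hU, hb⟩ := hC F
    exact ⟨⟨U, h⟩, hU, hb⟩
  · exact Subtype.ext (eq_zero_of_applyAF_eq_smul hs U.2 (sub_eq_zero.1 hU).symm)

/-! ## The stationary state -/

namespace Bar

/-- The stationary profile counts as a harmonic solution at frequency `0` without forcing, so that
`Bar.IsHarmonicSolution.exists_state`, which allows `s = 0`, turns it into a state. The forcings are
only required to equal `0`, because there they appear as combinations of components of `F = 0`. -/
lemma isHarmonicSolution_zeta (P : Bar) {g₂ g₄ : L2 P.mid} {h : L2 P.out} (hg₂ : g₂ = 0)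
    (hg₄ : g₄ = 0) (hh : h = 0) :
    P.IsHarmonicSolution 0 g₂ g₄ h (fun x => (P.zeta1 x : ℂ))
      (fun _ => (((P.L₂ - P.L₁ - P.L₃) / (P.L₁ * P.L₃) : ℝ) : ℂ)) (fun _ => (P.zeta3 : ℂ))
      (fun _ => 0) (fun x => (P.zeta2 x : ℂ))
      (fun _ => (((P.L₂ - P.L₁) / (P.L₁ * P.L₃) : ℝ) : ℂ)) := by
  have l1 := P.hL₁
  have l2 := P.hL₂
  have l3 := P.hL₃
  have l1' := l1.ne'
  have l3' : P.L₃ ≠ 0 := (l1.trans (l2.trans l3)).ne'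
  have hm' := P.hm.ne'
  have hlt : ¬ P.L₂ ≤ P.L₁ := not_le.2 l2
  have hlt3 : ¬ P.L₃ ≤ P.L₁ := not_le.2 (l2.trans l3)
  have affine : ∀ (r e α β : ℝ),
      IsPrimitiveOn (fun x : ℝ => ((r * x + e : ℝ) : ℂ)) (fun _ => (r : ℂ)) α β := by
    intro r e α β
    refine .of_hasDerivAt (fun x => ?_) continuous_const
    have : HasDerivAt (fun x : ℝ => r * x + e) r x := by
      simpa using ((hasDerivAt_id x).const_mul r).add_const e
    exact this.ofReal_comp
  have const : ∀ (r : ℂ) (α β : ℝ), IsPrimitiveOn (fun _ : ℝ => r) (fun _ => 0) α β :=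
    fun r α β => .of_hasDerivAt (fun x => hasDerivAt_const x r) continuous_const
  have g₂0 : ∀ᵐ x ∂volume.restrict (Ioo P.L₁ P.L₂), g₂ x = 0 := by
    rw [hg₂]; exact Lp.coeFn_zero ℂ 2 (volume.restrict P.mid)
  have g₄0 : ∀ᵐ x ∂volume.restrict (Ioo P.L₁ P.L₂), g₄ x = 0 := by
    rw [hg₄]; exact Lp.coeFn_zero ℂ 2 (volume.restrict P.mid)
  have h0 : ∀ᵐ x ∂volume.restrict P.out, h x = 0 := by
    rw [hh]; exact Lp.coeFn_zero ℂ 2 (volume.restrict P.out)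
  have hl0 : ∀ᵐ x ∂volume.restrict (Ioo 0 P.L₁), h x = 0 :=
    ae_mono (Measure.restrict_mono subset_union_left le_rfl) h0
  have hr0 : ∀ᵐ x ∂volume.restrict (Ioo P.L₂ P.L₃), h x = 0 :=
    ae_mono (Measure.restrict_mono subset_union_right le_rfl) h0
  constructor
  · exact affine _ _ _ _
  · refine (const _ _ _).congr_ae l2.le ?_
    filter_upwards [g₂0] with x hx
    simp [hx]
  · exact const _ _ _
  · refine (const _ _ _).congr_ae l2.le ?_
    filter_upwards [g₄0] with x hx
    simp [hx]
  · refine (affine ((P.L₂ - P.L₁) / (P.L₁ * P.L₃)) 0 _ _).congr_left fun x hx => ?_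
    rw [zeta2, if_pos hx.2, add_zero]
  · refine (affine ((P.L₂ - P.L₁) / (P.L₁ * P.L₃)) (-((P.L₂ - P.L₁) / P.L₁)) _ _).congr_left
      fun x hx => ?_
    rw [zeta2, if_neg (not_le.2 (l2.trans_le hx.1)), sub_eq_add_neg]
  · refine (const _ _ _).congr_ae l1.le ?_
    filter_upwards [hl0] with x hx
    simp [hx]
  · refine (const _ _ _).congr_ae l3.le ?_
    filter_upwards [hr0] with x hx
    simp [hx]
  · simp [zeta2, l1.le]
  · rw [zeta2, if_neg hlt3]
    norm_cast
    field_simp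
    ring
  · rw [zeta1, zeta2, if_pos le_rfl]
    norm_cast
    field_simp
    ring
  · rw [zeta1, zeta2, if_neg hlt]
    norm_cast
    field_simp
    ring
  · rw [zeta3]
    norm_cast
    field_simp
    ring
  · rw [zeta3]
    norm_cast
    field_simp
    ring
  · rfl
  · rfl

end Bar

lemma exists_stationary_state (P : Bar) :
    ∃ (Z : HF P) (h : Z ∈ domAF P), applyAF P Z h = 0 ∧
      IsContRep Z.u1 (fun x => (P.zeta1 x : ℂ)) ∧ IsContRep Z.v1 (fun x => (P.zeta2 x : ℂ)) ∧
      IsContRep Z.θ (fun _ => (P.zeta3 : ℂ)) ∧ Z.u2 = 0 ∧ Z.v2 = 0 := by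
  have wz : wderiv (0 : HF P).u1 = 0 := wderiv_zero P.isOpen_mid
  obtain ⟨Z, h, hZ, h1, -, h3, h4, -, h6, h7⟩ := (P.isHarmonicSolution_zeta
    (g₂ := (-(P.a : ℂ)⁻¹) • ((Complex.I * (0 : ℝ)) • (0 : HF P).u1 + (0 : HF P).u2))
    (g₄ := (-((P.k : ℂ) ^ 2)⁻¹) • ((0 : HF P).θ + (P.m : ℂ) • wderiv (0 : HF P).u1))
    (h := (-(P.b : ℂ)⁻¹) • ((Complex.I * (0 : ℝ)) • (0 : HF P).v1 + (0 : HF P).v2))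
    (by simp) (by rw [wz]; simp) (by simp)).exists_state
  refine ⟨Z, h, ?_, h1, h4, h3, ?_, ?_⟩
  · simpa using hZ
  · simpa using h6
  · simpa using h7

/-- All profiles in the kernel are affine on each interval, and the boundary conditions leave one
free parameter, the slope `w₀` of the elastic parts. -/
lemma kernel_subset_span {Z : HF P} (hZ1 : IsContRep Z.u1 (fun x => (P.zeta1 x : ℂ)))
    (hZ2 : IsContRep Z.v1 (fun x => (P.zeta2 x : ℂ)))
    (hZ3 : IsContRep Z.θ (fun _ => (P.zeta3 : ℂ))) (hZ4 : Z.u2 = 0) (hZ5 : Z.v2 = 0) {U : HF P}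
    (hU : U ∈ domAF P) (h : applyAF P U hU = 0) : ∃ r : ℂ, r • Z = U := by
  have l1 := P.hL₁
  have l2 := P.hL₂
  have l3 := P.hL₃
  have ha : (P.a : ℂ) ≠ 0 := by exact_mod_cast P.ha.ne'
  have hb : (P.b : ℂ) ≠ 0 := by exact_mod_cast P.hb.ne'
  have hm : (P.m : ℂ) ≠ 0 := by exact_mod_cast P.hm.ne'
  have hk : (P.k : ℂ) ^ 2 ≠ 0 := pow_ne_zero 2 (by exact_mod_cast P.hk.ne')
  have hL1 : (P.L₁ : ℂ) ≠ 0 := by exact_mod_cast l1.ne'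
  have hL3 : (P.L₃ : ℂ) ≠ 0 := by exact_mod_cast (l1.trans (l2.trans l3)).ne'
  have hL21 : (P.L₂ : ℂ) - P.L₁ ≠ 0 := by exact_mod_cast (sub_pos.2 l2).ne'
  have om := P.isOpen_mid
  have oo := P.isOpen_out
  have E1 : U.u2 = 0 := congrArg HF.u1 h
  have E2 : U.v2 = 0 := congrArg HF.v1 h
  have E3 : (P.k : ℂ) ^ 2 • wderiv (wderiv U.θ) - (P.m : ℂ) • wderiv U.u2 = 0 :=
    congrArg HF.θ h
  have E4 : (P.a : ℂ) • wderiv (wderiv U.u1) - (P.m : ℂ) • wderiv U.θ = 0 :=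
    congrArg HF.u2 h
  have E5 : (P.b : ℂ) • wderiv (wderiv U.v1) = 0 := congrArg HF.v2 h
  obtain ⟨⟨mu, mu'⟩, ⟨mv, mv'⟩, ⟨mt, mt'⟩, -, -, -, ⟨p, t, w, hp, ht, hw, hf1, hf2⟩,
    ⟨q, hq, hq1, -⟩⟩ := hU
  obtain ⟨u, v, hu, hv, hv0, hv3, hc1, hc2⟩ := U.compatible
  have m0 : (0 : ℝ) ∈ Icc 0 P.L₁ := ⟨le_rfl, P.hL₁.le⟩
  have m1 : P.L₁ ∈ Icc 0 P.L₁ := ⟨P.hL₁.le, le_rfl⟩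
  have m2 : P.L₂ ∈ Icc P.L₂ P.L₃ := ⟨le_rfl, P.hL₃.le⟩
  have m3 : P.L₃ ∈ Icc P.L₂ P.L₃ := ⟨P.hL₃.le, le_rfl⟩
  have n1 : P.L₁ ∈ Icc P.L₁ P.L₂ := ⟨le_rfl, P.hL₂.le⟩
  have n2 : P.L₂ ∈ Icc P.L₁ P.L₂ := ⟨P.hL₂.le, le_rfl⟩
  -- Now `θ_xx = 0`, so `θ_x` is constant; insulation at `L₁` makes it `0`, and `θ` is constant.
  rw [E1, wderiv_zero om, smul_zero, sub_zero, smul_eq_zero_iff_right hk] at E3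
  obtain ⟨q₀, eq⟩ := hq.eq_of_hasWeakDeriv_zero (E3 ▸ hasWeakDeriv_wderiv mt') l2 subset_rfl
  have hq₀ : q₀ = 0 := by rw [← eq _ n1, hq1]
  have wt : wderiv U.θ = 0 := hq.eq_of_eqOn om.measurableSet IsContRep.zero
    fun x hx => by rw [eq x (Ioo_subset_Icc_self hx), hq₀]; rfl
  obtain ⟨t₀, et⟩ := ht.eq_of_hasWeakDeriv_zero (wt ▸ hasWeakDeriv_wderiv mt) l2 subset_rfl
  rw [wt, smul_zero, sub_zero, smul_eq_zero_iff_right ha] at E4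
  rw [smul_eq_zero_iff_right hb] at E5
  obtain ⟨p₀, ep⟩ := hp.eq_of_hasWeakDeriv_zero (E4 ▸ hasWeakDeriv_wderiv mu') l2 subset_rfl
  have dw : HasWeakDeriv (wderiv U.v1) 0 := E5 ▸ hasWeakDeriv_wderiv mv'
  obtain ⟨w₀, ewl⟩ := hw.eq_of_hasWeakDeriv_zero dw l1 subset_union_left
  obtain ⟨w₁, ewr⟩ := hw.eq_of_hasWeakDeriv_zero dw l3 subset_union_right
  rw [ep _ n1, et _ n1, ewl _ m1] at hf1
  rw [ep _ n2, et _ n2, ewr _ m2, hf1] at hf2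
  -- The force `a u_x - m θ` is the same constant at both interfaces, so the elastic slopes agree.
  obtain rfl : w₀ = w₁ := mul_left_cancel₀ hb hf2
  have vl : ∀ x ∈ Icc 0 P.L₁, v x = x * w₀ := fun x hx => by
    have := hv.sub_eq_mul hw (hasWeakDeriv_wderiv mv) l1 subset_union_left ewl m0 hx
    rw [hv0] at this
    simpa using this
  have vr : ∀ x ∈ Icc P.L₂ P.L₃, v x = (x - P.L₃) * w₀ := fun x hx => by
    have := hv.sub_eq_mul hw (hasWeakDeriv_wderiv mv) l3 subset_union_right ewr m3 hx
    rwa [hv3, sub_zero] at this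
  have um : ∀ x ∈ Icc P.L₁ P.L₂, u x = P.L₁ * w₀ + (x - P.L₁) * p₀ := fun x hx => by
    have := hu.sub_eq_mul hp (hasWeakDeriv_wderiv mu) l2 subset_rfl ep n1 hx
    rw [hc1, vl _ m1] at this
    linear_combination this
  -- Continuity at `L₂`, with `v` integrated from the right end and `u` from `L₁`, fixes the slope
  -- in the middle.
  have hp₀ : p₀ = (P.L₂ - P.L₁ - P.L₃) / (P.L₂ - P.L₁) * w₀ := by
    have := um _ n2
    rw [hc2, vr _ m2] at this
    field_simp
    linear_combination -this
  have ht₀ : t₀ = (P.a * p₀ - P.b * w₀) / P.m := by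
    field_simp
    linear_combination -hf1
  -- The factor is `w₀` divided by the slope `(L₂ - L₁) / (L₁ L₃)` of `ζ²`.
  refine ⟨P.L₁ * P.L₃ / (P.L₂ - P.L₁) * w₀, HF.ext ?_ ?_ ?_ ?_ ?_⟩
  · refine (hZ1.smul _).eq_of_eqOn om.measurableSet hu fun x hx => ?_
    rw [um x (Ioo_subset_Icc_self hx), hp₀]
    simp only [Pi.smul_apply, smul_eq_mul, Bar.zeta1]
    push_cast
    field_simp
    ring
  · refine (hZ2.smul _).eq_of_eqOn oo.measurableSet hv fun x hx => ?_
    simp only [Pi.smul_apply, smul_eq_mul, Bar.zeta2]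
    rcases hx with hx | hx
    · rw [vl x (Ioo_subset_Icc_self hx), if_pos hx.2.le]
      push_cast
      field_simp
    · rw [vr x (Ioo_subset_Icc_self hx), if_neg (not_le.2 (l2.trans hx.1))]
      push_cast
      field_simp
  · refine (hZ3.smul _).eq_of_eqOn om.measurableSet ht fun x hx => ?_
    rw [et x (Ioo_subset_Icc_self hx), ht₀, hp₀]
    simp only [Pi.smul_apply, smul_eq_mul, Bar.zeta3]
    push_cast
    field_simp
  · rw [HF.u2_smul, hZ4, E1, smul_zero]
  · rw [HF.v2_smul, hZ5, E2, smul_zero]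

/-- If the state were zero, continuity would make `ζ²` vanish on all of `[0, L₁]`, but `ζ²(L₁) = (L₂
- L₁) / L₃ > 0`. -/
lemma stationary_state_ne_zero {Z : HF P} (hZ : IsContRep Z.v1 (fun x => (P.zeta2 x : ℂ))) :
    Z ≠ 0 := by
  rintro rfl
  have l1 := P.hL₁
  have l2 := P.hL₂
  have hcl : Icc 0 P.L₁ ⊆ closure P.out := by
    rw [P.closure_out]; exact subset_union_left
  have hae : (fun x => (P.zeta2 x : ℂ)) =ᵐ[volume.restrict (Icc 0 P.L₁)] fun _ => 0 := by
    rw [← restrict_Ioo_eq_restrict_Icc]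
    refine ae_mono (Measure.restrict_mono subset_union_left le_rfl : _ ≤ volume.restrict P.out) ?_
    exact hZ.2.symm.trans (Lp.coeFn_zero ℂ 2 (volume.restrict P.out))
  have h := Measure.eqOn_Icc_of_ae_eq volume l1.ne hae (hZ.1.mono hcl) continuousOn_const
    ⟨l1.le, le_rfl⟩
  have h3 := l1.trans (l2.trans P.hL₃)
  have h21 := sub_pos.2 l2
  have hpos : 0 < P.zeta2 P.L₁ := by
    rw [Bar.zeta2, if_pos le_rfl]
    positivity
  exact hpos.ne' (Complex.ofReal_eq_zero.1 h)

end Transmission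

/-! ### Spectrum on the imaginary axis and stationary states -/

theorem mainTheorem7 (P : Transmission.Bar) :
    (0 : ℂ) ∈ Transmission.spectrumOf (Transmission.AF P) ∧
    {z : ℂ | z.re = 0} ∩ Transmission.spectrumOf (Transmission.AF P) = {0} ∧
    ∃ Z : Transmission.HF P,
      (Z.u1 =ᵐ[volume.restrict P.mid] fun x => (P.zeta1 x : ℂ)) ∧
      (Z.v1 =ᵐ[volume.restrict P.out] fun x => (P.zeta2 x : ℂ)) ∧
      (Z.θ =ᵐ[volume.restrict P.mid] fun _ => (P.zeta3 : ℂ)) ∧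
      Z.u2 = 0 ∧ Z.v2 = 0 ∧
      Transmission.kerOf (Transmission.AF P) = Submodule.span ℂ {Z} ∧
      Transmission.stationarySolutions (Transmission.AF P) =
        (Transmission.kerOf (Transmission.AF P) : Set (Transmission.HF P)) := by
  obtain ⟨Z, hd, hZ, h1, h2, h3, h4, h5⟩ := Transmission.exists_stationary_state P
  have hker : Z ∈ Transmission.kerOf (Transmission.AF P) := Transmission.mem_kerOf.2 ⟨hd, hZ⟩
  have h0 := Transmission.zero_mem_spectrumOf hker (Transmission.stationary_state_ne_zero h2)
  refine ⟨h0, ?_, Z, h1.2, h2.2, h3.2, h4, h5, ?_, Transmission.stationarySolutions_eq_kerOf _⟩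
  · refine Subset.antisymm ?_ (singleton_subset_iff.2 ⟨Complex.zero_re, h0⟩)
    rintro z ⟨hz, hσ⟩
    by_contra hz0
    have him : z.im ≠ 0 := fun h => hz0 (Complex.ext hz h)
    have e : z = Complex.I * (z.im : ℂ) := by
      apply Complex.ext <;> simp [show z.re = 0 from hz]
    rw [e] at hσ
    exact hσ (Transmission.I_mul_mem_resolventSetOf P him)
  · refine le_antisymm (fun U hU => ?_) ?_
    · obtain ⟨hUd, hU0⟩ := Transmission.mem_kerOf.1 hU
      exact Submodule.mem_span_singleton.2
        (Transmission.kernel_subset_span h1 h2 h3 h4 h5 hUd hU0)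
    · rw [Submodule.span_singleton_le_iff_mem]
      exact hker
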